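/- **Proposition.** Let $f:\mathbb R\to\mathbb R$ be one-periodic, of class $C^3$, with finitely many local extrema per period. Let $N\ge 1$ be an integer and $\gamma:[0,1]\to[0,N]$ an increasing bijection of class $C^3$. *Diagrams.* For a continuous function $g$ on the circle $\mathbb R/\mathbb Z$, let $D(g)$ be the degree-zero persistence diagram of its sublevel set filtration, i.e. the multiset of (birth, death) pairs $(b,d)$ with $b<d$, where the death value of the component that never dies is set to $\max g$; let $\mu_g$ be the associated counting measure on $\mathbb R^2$, and let $\gcd\emptyset=1$. Distances in $\mathbb R^2$ are sup-norm distances, $B(p,\tau)$ is the ball of radius $\tau$ around $p$, and $\Delta$ is the diagonal. For $\tau>0$ put $$\hat N(g,\tau)=\gcd\{\mu_g(B(p,\tau)) : p=(b,d)\in\operatorname{supp}\mu_g,\ d-b>2\tau\}.$$ View $f|_{[0,1]}$ as a function on the circle. Assume that $f$ is non-degenerate, i.e. $\gcd\{\mu_f(\{p\}) : p\in\operatorname{supp}\mu_f\}=1$, and let $$\delta=\min\big(\{d(p,q): p\ne q\in\operatorname{supp}\mu_f\}\cup\{d(p,\Delta): p\in\operatorname{supp}\mu_f\}\big).$$ *Observation.*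 Let $\omega\geq 1$ be real, $M=\lfloor\omega\rfloor$, $\sigma>0$, let $W_1,\dots,W_M$ be i.i.d. $\mathcal N(0,\sigma^2)$ random variables, and let $S_m=f(\gamma(\tfrac{m-1}{\omega}))+W_m$ for $1\le m\le M$. Let $F(S)$ be the piecewise linear function on $[0,\tfrac M\omega]$ that interpolates the values $S_1,\dots,S_M,S_1$ at the nodes $0,\tfrac1\omega,\dots,\tfrac{M-1}\omega,\tfrac M\omega$. Since it takes the same value at both ends, view it (after rescaling) as a function on the circle. *Claim.* Let $0<\tau<\delta/3$ be such that $\alpha:=\tfrac\tau2-\tfrac1{\omega^2}C_{f,\gamma}>0$, where $$C_{f,\gamma}=\|f''\|_\infty\|\gamma'\|_\infty^2+\|f'\|_\infty\|\gamma''\|_\infty+\tfrac12\big(\|f'''\|_\infty\|\gamma'\|_\infty^3+3\|f''\|_\infty\|\gamma'\|_\infty\|\gamma''\|_\infty+\|f'\|_\infty\|\gamma'''\|_\infty\big).$$ Then, with $\Phi$ the cumulative distribution function of the standard normal law, $$P\big(\hat N(F(S),\tau)=N\big)\ \ge\ \big(1-2\Phi(-\tfrac\alpha\sigma)\big)^{\omega}.$$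 The base $1-2\Phi(-\alpha/\sigma)$ is $P(|W_1|\le\alpha)$. -/

import Mathlib

open MeasureTheory ProbabilityTheory

noncomputable section

namespace PeriodInference

/-! ### Zero-dimensional persistence of a sublevel set filtration -/

/-- The number of connected components of the sublevel set `{g ≤ t}` that meet `{g ≤ s}`
(for `s ≤ t`): the rank of `H₀{g ≤ s} → H₀{g ≤ t}`.  The component that never dies
is given the death value `max g`, so the rank is set to `0` as soon as `t ≥ max g`. -/
def sublevelRank {X : Type*} [TopologicalSpace X] (g : X → ℝ) (s t : ℝ) : ℕ :=
  open Classical in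
  if ∃ x, t < g x then
    ((fun x => connectedComponentIn {y | g y ≤ t} x) '' {x | g x ≤ s}).ncard
  else 0

/-- The number of points of the diagram of `g` with birth value in `(b - ε, b + ε]` and death
value in `(d - ε, d + ε]`, by inclusion-exclusion. -/
def boxCount {X : Type*} [TopologicalSpace X] (g : X → ℝ) (b d ε : ℝ) : ℤ :=
  (sublevelRank g (b + ε) (d - ε) : ℤ) - sublevelRank g (b - ε) (d - ε)
    - sublevelRank g (b + ε) (d + ε) + sublevelRank g (b - ε) (d + ε)

/-- The multiplicity `⟨p⟩_g` of the point `p = (b, d)` in the persistence diagram of `g`: the number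
of points in all sufficiently small boxes around `p`.  It is `0` unless `b < d`, so points of
the diagonal do not count. -/
def pointMultiplicity {X : Type*} [TopologicalSpace X] (g : X → ℝ) (p : ℝ × ℝ) : ℕ :=
  sInf {n : ℕ | ∃ ε : ℝ, 0 < ε ∧ 2 * ε < p.2 - p.1 ∧ (n : ℤ) = boxCount g p.1 p.2 ε}

/-- The support of the persistence measure `μ_g`. -/
def diagramSupport {X : Type*} [TopologicalSpace X] (g : X → ℝ) : Set (ℝ × ℝ) :=
  {p | 0 < pointMultiplicity g p}

/-- The diagonal of the plane. -/
def diagonal : Set (ℝ × ℝ) := {p | p.1 = p.2}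

/-- The separation `δ` of the diagram of `g`: the least distance, in the sup norm of `ℝ × ℝ`, between
two distinct points of the diagram or between such a point and the diagonal. -/
def separation {X : Type*} [TopologicalSpace X] (g : X → ℝ) : ℝ :=
  sInf ({r | ∃ p ∈ diagramSupport g, ∃ q ∈ diagramSupport g, p ≠ q ∧ r = dist p q} ∪
    {r | ∃ p ∈ diagramSupport g, r = Metric.infDist p diagonal})

/-- The greatest common divisor of a set of natural numbers, with `gcd ∅ = 1`. -/
def setGcd (A : Set ℕ) : ℕ :=
  open Classical in if A = ∅ then 1 else sSup {k : ℕ | ∀ a ∈ A, k ∣ a}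

/-- `N(g)`, the gcd of the multiplicities of the points of the diagram of `g`. -/
def multiplicityGcd {X : Type*} [TopologicalSpace X] (g : X → ℝ) : ℕ :=
  setGcd {n | ∃ p ∈ diagramSupport g, n = pointMultiplicity g p}

/-- `⟨p⟩_{g,τ} = μ_g(B(p, τ))`, the number of points, counted with multiplicity, of the diagram of
`g` in the sup norm ball of radius `τ` around `p`. -/
def ballMultiplicity {X : Type*} [TopologicalSpace X] (g : X → ℝ) (τ : ℝ) (p : ℝ × ℝ) : ℕ :=
  ∑ᶠ q ∈ Metric.closedBall p τ, pointMultiplicity g q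

/-- The estimator `N̂(g, τ)`: the gcd of `⟨p⟩_{g,τ}` over the points `p` of the diagram of `g`
with persistence more than `2τ`. -/
def estimator {X : Type*} [TopologicalSpace X] (g : X → ℝ) (τ : ℝ) : ℕ :=
  setGcd {n | ∃ p ∈ diagramSupport g, 2 * τ < p.2 - p.1 ∧ n = ballMultiplicity g τ p}

/-! ### Signals -/

/-- A function `h` on `[0, L]` with `h 0 = h L`, regarded as a function on the circle `ℝ/ℤ`. -/
def onCircle (L : ℝ) (h : ℝ → ℝ) : UnitAddCircle → ℝ :=
  AddCircle.liftIco 1 0 (fun t => h (L * t))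

/-- Linear interpolation at rate `ω`: on `[m/ω, (m+1)/ω)` it is the
affine function with values `a m` at `m/ω` and `a (m+1)` at `(m+1)/ω`. -/
def interpolate (ω : ℝ) (a : ℕ → ℝ) (t : ℝ) : ℝ :=
  a (⌊ω * t⌋₊ + 1) * (ω * t - ⌊ω * t⌋₊) + a ⌊ω * t⌋₊ * (⌊ω * t⌋₊ + 1 - ω * t)

/-- The noisy samples of `f ∘ γ` at the times `0, 1/ω, …, (M-1)/ω`. -/
def noisySample (f γ : ℝ → ℝ) (ω : ℝ) {M : ℕ} (w : Fin M → ℝ) : Fin M → ℝ :=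
  fun m => f (γ ((m : ℝ) / ω)) + w m

/-- The interpolation of `M` samples, a function on `[0, M/ω]`, closed up to a function on the circle
by letting the first sample follow the last one: the interpolated values at `0, 1/ω, …, M/ω`
are `S 0, …, S (M-1), S 0`. -/
def interpolatedSignal (ω : ℝ) {M : ℕ} [NeZero M] (S : Fin M → ℝ) : UnitAddCircle → ℝ :=
  onCircle (M / ω) (interpolate ω (fun k => S (Fin.ofNat M k)))

/-! ### The constant -/

/-- `‖f⁽ᵏ⁾‖_∞` for a function on the line. -/
def supDeriv (k : ℕ) (f : ℝ → ℝ) : ℝ := ⨆ x : ℝ, |iteratedDeriv k f x|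

/-- `‖γ⁽ᵏ⁾‖_∞` for a function on `[0, 1]`. -/
def supDerivUnit (k : ℕ) (γ : ℝ → ℝ) : ℝ :=
  ⨆ t : Set.Icc (0 : ℝ) 1, |iteratedDerivWithin k γ (Set.Icc 0 1) t|

/-- The constant `C_{f,γ}`. -/
def approxConst (f γ : ℝ → ℝ) : ℝ :=
  supDeriv 2 f * supDerivUnit 1 γ ^ 2 + supDeriv 1 f * supDerivUnit 2 γ
    + 1 / 2 * (supDeriv 3 f * supDerivUnit 1 γ ^ 3
      + 3 * supDeriv 2 f * supDerivUnit 1 γ * supDerivUnit 2 γ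
      + supDeriv 1 f * supDerivUnit 3 γ)

end PeriodInference

end

open PeriodInference

/-!
The proof is a stability argument for persistence diagrams, applied on the event that every noise
term is at most `α` in absolute value.

*Diagrams.* For a continuous function on a compact, locally connected space the ranks
`sublevelRank g s t` with `s < t` are finite, and every box above the diagonal has nonnegative
mass (`boxNonneg_rankFn`). This alone makes the diagram a locally finite counting measure above
the diagonal: a box of positive mass has a point of positive mass in its closure
(`exists_mass_pos`), and the mass of a box without such points on its boundary is the sum of the
masses of the points inside (`rect_eq_sum_mass`). Hence the multiplicity of a closed ball is the
mass of all slightly larger boxes.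

*Stability.* If `|g - h| ≤ ε`, the sublevel sets that bound a box for `g` and the enlarged box for
`h` form a chain of eight nested sets, and nonnegativity of the boxes of that chain gives the box
lemma (`nestedRank_box_mono`) and `ballMultiplicity_le`. With `ε = τ / 2` and `τ` less than a
third of the separation, every point of the diagram of `g` of persistence more than `2τ` is near
exactly one point of the diagram of `h`, with the same multiplicity in the ball of radius `τ`, and
each point of the diagram of `h` arises in this way (`estimator_eq`).

*Coverings.* Up to a homeomorphism of the circle, the noiseless signal is `f` composed with the
`N`-fold covering. Below the maximum the components of sublevel sets on the circle are intervals,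
so all ranks are multiplied by `N` (`sublevelRank_cover`), hence so are the multiplicities, whose
gcd becomes `N`.

*Approximation.* The interpolated signal is compared with `f ∘ γ` after the time change that is
affine between the sampling times, the last interval being stretched to reach time `1`. Its
intervals have length at most `2 / ω`, so the chord of `f ∘ γ` is off by at most `C / ω²`
(`abs_chord_comp_sub_le`), and the noise adds at most `α`; together this is at most `τ / 2`.

*Probability.* The `M ≤ ω` noise terms are independent, so the event has probability
`(1 - 2 Φ(-α / σ)) ^ M`, which is at least the claimed bound.
-/

open MeasureTheory ProbabilityTheory
noncomputable section
namespace PeriodInference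
open Set Filter Topology

/-! ### Counting functions of boxes above the diagonal -/

/-- The mass that a rank function `B` gives to the box `(a, b] × (c, d]`, by
inclusion-exclusion. -/
def rect (B : ℝ → ℝ → ℤ) (a b c d : ℝ) : ℤ := B b c - B a c - B b d + B a d

/-- All boxes above the diagonal have nonnegative mass. -/
def BoxNonneg (B : ℝ → ℝ → ℤ) : Prop :=
  ∀ ⦃a b c d : ℝ⦄, a ≤ b → b < c → c ≤ d → 0 ≤ rect B a b c d

/-- The mass of the point `p`: the least mass of a square centred at `p`. For the rank function of
`g` this unfolds to `pointMultiplicity g p`. -/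
def mass (B : ℝ → ℝ → ℤ) (p : ℝ × ℝ) : ℕ :=
  sInf {n : ℕ | ∃ ε : ℝ, 0 < ε ∧ 2 * ε < p.2 - p.1 ∧
    (n : ℤ) = rect B (p.1 - ε) (p.1 + ε) (p.2 - ε) (p.2 + ε)}

variable {B : ℝ → ℝ → ℤ}

lemma rect_mono (hB : BoxNonneg B) {a b c d a' b' c' d' : ℝ} (ha : a' ≤ a) (hab : a ≤ b)
    (hb : b ≤ b') (hbc : b' < c') (hc : c' ≤ c) (hcd : c ≤ d) (hd : d ≤ d') :
    rect B a b c d ≤ rect B a' b' c' d' := by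
  -- The complement is cut into a left and a right strip and the parts below and above the box.
  have h1 := hB ha (by linarith : a < c') (by linarith : c' ≤ d')
  have h2 := hB hb (by linarith : b' < c') (by linarith : c' ≤ d')
  have h3 := hB hab (by linarith : b < c') hc
  have h4 := hB hab (by linarith : b < d) hd
  unfold rect at *
  linarith

/-- The integer masses of the squares centred at `p` decrease with the radius, so they are
eventually constant, equal to the mass of `p`. -/
lemma mass_spec (hB : BoxNonneg B) {p : ℝ × ℝ} (hp : p.1 < p.2) :
    ∃ ε > 0, 2 * ε < p.2 - p.1 ∧ ∀ η, 0 < η → η ≤ ε →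
      rect B (p.1 - η) (p.1 + η) (p.2 - η) (p.2 + η) = mass B p := by
  set A := {n : ℕ | ∃ ε : ℝ, 0 < ε ∧ 2 * ε < p.2 - p.1 ∧
    (n : ℤ) = rect B (p.1 - ε) (p.1 + ε) (p.2 - ε) (p.2 + ε)} with hA
  have key : ∀ ε : ℝ, 0 < ε → 2 * ε < p.2 - p.1 →
      (mass B p : ℤ) ≤ rect B (p.1 - ε) (p.1 + ε) (p.2 - ε) (p.2 + ε) := by
    intro ε h0 h1
    have hn := hB (a := p.1 - ε) (b := p.1 + ε) (c := p.2 - ε) (d := p.2 + ε)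
      (by linarith) (by linarith) (by linarith)
    lift rect B (p.1 - ε) (p.1 + ε) (p.2 - ε) (p.2 + ε) to ℕ using hn with n hn'
    exact_mod_cast Nat.sInf_le (s := A) ⟨ε, h0, h1, hn'⟩
  have hne : A.Nonempty := by
    refine ⟨(rect B (p.1 - (p.2 - p.1) / 3) (p.1 + (p.2 - p.1) / 3) (p.2 - (p.2 - p.1) / 3)
      (p.2 + (p.2 - p.1) / 3)).toNat, (p.2 - p.1) / 3, by linarith, by linarith, ?_⟩
    exact Int.toNat_of_nonneg (hB (by linarith) (by linarith) (by linarith))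
  obtain ⟨ε, h0, h1, h2⟩ := Nat.sInf_mem hne
  refine ⟨ε, h0, h1, fun η hη0 hηε => le_antisymm ?_ (key η hη0 (by linarith))⟩
  change _ ≤ ((sInf A : ℕ) : ℤ)
  rw [h2]
  exact rect_mono hB (by linarith) (by linarith) (by linarith) (by linarith) (by linarith)
    (by linarith) (by linarith)

lemma fst_lt_snd_of_mass_pos {p : ℝ × ℝ} (hp : 0 < mass B p) : p.1 < p.2 := by
  by_contra h
  have : mass B p = 0 := by
    unfold mass
    convert Nat.sInf_empty
    ext n
    simp only [mem_ofPred_eq, mem_empty_iff_false, iff_false]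
    rintro ⟨ε, h0, h1, -⟩
    linarith
  omega

/-- A predicate on `[c, d]` that holds at `c` and fails at `d` changes at some point of
`[c, d]`. -/
lemma exists_switch {c d : ℝ} (hcd : c ≤ d) {Z : ℝ → Prop} (hc : Z c) (hd : ¬ Z d) :
    ∃ y ∈ Icc c d, ∀ η > 0, ∃ u ∈ Icc c d, ∃ v ∈ Icc c d,
      y - η < u ∧ u ≤ y ∧ y ≤ v ∧ v < y + η ∧ Z u ∧ ¬ Z v := by
  set A := {y | y ∈ Icc c d ∧ Z y} with hA
  have hcA : c ∈ A := ⟨⟨le_rfl, hcd⟩, hc⟩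
  have hbdd : BddAbove A := ⟨d, fun y hy => hy.1.2⟩
  have hle : sSup A ≤ d := csSup_le ⟨c, hcA⟩ fun y hy => hy.1.2
  refine ⟨sSup A, ⟨le_csSup hbdd hcA, hle⟩, fun η hη => ?_⟩
  obtain ⟨u, huA, hu⟩ := exists_lt_of_lt_csSup ⟨c, hcA⟩ (by linarith : sSup A - η < sSup A)
  refine ⟨u, huA.1, ?_⟩
  rcases eq_or_lt_of_le hle with h | h
  · exact ⟨d, ⟨hcd, le_rfl⟩, hu, le_csSup hbdd huA, hle, by linarith, huA.2, hd⟩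
  · obtain ⟨v, hv1, hv2⟩ := exists_between (lt_min h (by linarith : sSup A < sSup A + η))
    have hv3 := lt_min_iff.1 hv2
    have hvI : v ∈ Icc c d := ⟨by linarith [le_csSup hbdd hcA], hv3.1.le⟩
    exact ⟨v, hvI, hu, le_csSup hbdd huA, hv1.le, hv3.2, huA.2,
      fun hZ => absurd (le_csSup hbdd (show v ∈ A from ⟨hvI, hZ⟩)) (not_le.2 hv1)⟩

/-- A box of positive mass has a point of positive mass in its closure. The point is found one
coordinate at a time, as the place where the mass of an initial part of the box becomes
positive. -/
lemma exists_mass_pos (hB : BoxNonneg B) {a b c d : ℝ} (hab : a ≤ b) (hbc : b < c) (hcd : c ≤ d)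
    (hpos : 0 < rect B a b c d) : ∃ p : ℝ × ℝ, p.1 ∈ Icc a b ∧ p.2 ∈ Icc c d ∧ 0 < mass B p := by
  -- Every vertical strip around the line over `x` carries mass.
  obtain ⟨x, hx, hxs⟩ := exists_switch hab (Z := fun x => rect B a x c d = 0)
    (by simp [rect]) hpos.ne'
  have hstrip : ∀ ε > 0, ε < c - b → 0 < rect B (x - ε) (x + ε) c d := by
    intro ε h0 h1
    obtain ⟨u, hu, v, hv, h2, h3, h4, h5, h6, h7⟩ := hxs ε h0
    have h8 : rect B a v c d = rect B a u c d + rect B u v c d := by unfold rect; ring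
    have h9 := hB (h3.trans h4) (by linarith [hv.2] : v < c) hcd
    have h10 : 0 < rect B u v c d := by
      refine lt_of_le_of_ne h9 fun h => h7 ?_
      rw [h8, h6, ← h, add_zero]
    exact h10.trans_le
      (rect_mono hB h2.le (h3.trans h4) h5.le (by linarith [hx.2]) le_rfl hcd le_rfl)
  -- Below height `y` some strip carries no mass, above `y` all strips do.
  obtain ⟨y, hy, hys⟩ := exists_switch hcd
    (Z := fun y => ∃ ε > 0, ε < c - b ∧ rect B (x - ε) (x + ε) c y = 0)
    ⟨(c - b) / 2, by linarith, by linarith, by simp [rect]⟩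
    (by rintro ⟨ε, h0, h1, h2⟩; exact (hstrip ε h0 h1).ne' h2)
  refine ⟨(x, y), hx, hy, ?_⟩
  have hxy : x < y := by linarith [hx.2, hy.1]
  obtain ⟨ε₂, h0, h1, h2⟩ := mass_spec hB (p := (x, y)) hxy
  simp only at h1 h2
  obtain ⟨u, hu, v, hv, h3, h4, h5, h6, ⟨ε₁, h7, h8, h9⟩, h10⟩ := hys ε₂ h0
  set ε := min ε₁ ε₂
  have hε0 : 0 < ε := lt_min h7 h0
  have hε1 : ε ≤ ε₁ := min_le_left _ _
  have hε2 : ε ≤ ε₂ := min_le_right _ _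
  have e1 : rect B (x - ε) (x + ε) c u = 0 :=
    le_antisymm (h9 ▸ rect_mono hB (by linarith) (by linarith) (by linarith) (by linarith [hx.2])
      le_rfl hu.1 le_rfl) (hB (by linarith) (by linarith [hx.2]) hu.1)
  have e2 : 0 < rect B (x - ε) (x + ε) c v :=
    lt_of_le_of_ne (hB (by linarith) (by linarith [hx.2]) hv.1)
      fun h => h10 ⟨ε, hε0, by linarith, h.symm⟩
  have e3 : rect B (x - ε) (x + ε) c v
      = rect B (x - ε) (x + ε) c u + rect B (x - ε) (x + ε) u v := by unfold rect; ring
  have e4 : rect B (x - ε) (x + ε) u v ≤ rect B (x - ε₂) (x + ε₂) (y - ε₂) (y + ε₂) :=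
    rect_mono hB (by linarith) (by linarith) (by linarith) (by linarith) h3.le (h4.trans h5) h6.le
  rw [h2 ε₂ h0 le_rfl] at e4
  have : (0 : ℤ) < mass B (x, y) := by linarith
  exact_mod_cast this

lemma rect_eq_zero (hB : BoxNonneg B) {a b c d : ℝ} (hab : a ≤ b) (hbc : b < c) (hcd : c ≤ d)
    (h : ∀ p : ℝ × ℝ, p.1 ∈ Icc a b → p.2 ∈ Icc c d → mass B p = 0) : rect B a b c d = 0 := by
  by_contra h'
  obtain ⟨p, h1, h2, h3⟩ := exists_mass_pos hB hab hbc hcd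
    (lt_of_le_of_ne (hB hab hbc hcd) (Ne.symm h'))
  exact h3.ne' (h p h1 h2)

/-- A value strictly between two others that avoids a finite set. -/
lemma exists_between_avoiding (T : Finset ℝ) {x y : ℝ} (h : x < y) : ∃ m ∈ Ioo x y, m ∉ T := by
  obtain ⟨m, hm, hmT⟩ := (Ioo_infinite h).exists_notMem_finset T
  exact ⟨m, hm, hmT⟩

/-- Induction over boxes with finitely many marked interior points, by cutting along lines that
avoid the marked points. -/
lemma box_induction {P : ℝ → ℝ → ℝ → ℝ → Finset (ℝ × ℝ) → Prop}
    (h0 : ∀ a b c d, a ≤ b → b < c → c ≤ d → P a b c d ∅)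
    (h1 : ∀ a b c d p, b < c → p.1 ∈ Ioo a b → p.2 ∈ Ioo c d → P a b c d {p})
    (hx : ∀ a m b c d S, a ≤ m → m ≤ b → b < c → c ≤ d → (∀ p ∈ S, p.1 ≠ m) →
      P a m c d (S.filter fun p => p.1 < m) → P m b c d (S.filter fun p => ¬ p.1 < m) → P a b c d S)
    (hy : ∀ a b c m d S, a ≤ b → b < c → c ≤ m → m ≤ d → (∀ p ∈ S, p.2 ≠ m) →
      P a b c m (S.filter fun p => p.2 < m) → P a b m d (S.filter fun p => ¬ p.2 < m) → P a b c d S)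
    (S : Finset (ℝ × ℝ)) : ∀ a b c d, a ≤ b → b < c → c ≤ d →
      (∀ p ∈ S, p.1 ∈ Ioo a b ∧ p.2 ∈ Ioo c d) → P a b c d S := by
  classical
  induction S using Finset.strongInduction with
  | H S ih =>
    intro a b c d hab hbc hcd hS
    rcases S.eq_empty_or_nonempty with rfl | ⟨p, hp⟩
    · exact h0 a b c d hab hbc hcd
    by_cases hone : ∀ q ∈ S, q = p
    · have : S = {p} := Finset.eq_singleton_iff_unique_mem.2 ⟨hp, hone⟩
      subst this
      exact h1 a b c d p hbc (hS p hp).1 (hS p hp).2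
    push Not at hone
    obtain ⟨q, hq, hqp⟩ := hone
    have main1 : ∀ p ∈ S, ∀ q ∈ S, p.1 < q.1 → P a b c d S := by
      intro p hp q hq hlt
      obtain ⟨m, hm, hmT⟩ := exists_between_avoiding (S.image Prod.fst) hlt
      have hne : ∀ r ∈ S, r.1 ≠ m := fun r hr h => hmT (Finset.mem_image.2 ⟨r, hr, h⟩)
      have ham : a < m := (hS p hp).1.1.trans hm.1
      have hmb : m < b := hm.2.trans (hS q hq).1.2
      refine hx a m b c d S ham.le hmb.le hbc hcd hne (ih _ ?_ a m c d ham.le (by linarith) hcd ?_)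
        (ih _ ?_ m b c d hmb.le hbc hcd ?_)
      · exact Finset.filter_ssubset.2 ⟨q, hq, not_lt.2 hm.2.le⟩
      · intro r hr
        rw [Finset.mem_filter] at hr
        exact ⟨⟨(hS r hr.1).1.1, hr.2⟩, (hS r hr.1).2⟩
      · exact Finset.filter_ssubset.2 ⟨p, hp, not_not.2 hm.1⟩
      · intro r hr
        rw [Finset.mem_filter] at hr
        exact ⟨⟨lt_of_le_of_ne (not_lt.1 hr.2) (hne r hr.1).symm, (hS r hr.1).1.2⟩, (hS r hr.1).2⟩
    have main2 : ∀ p ∈ S, ∀ q ∈ S, p.2 < q.2 → P a b c d S := by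
      intro p hp q hq hlt
      obtain ⟨m, hm, hmT⟩ := exists_between_avoiding (S.image Prod.snd) hlt
      have hne : ∀ r ∈ S, r.2 ≠ m := fun r hr h => hmT (Finset.mem_image.2 ⟨r, hr, h⟩)
      have ham : c < m := (hS p hp).2.1.trans hm.1
      have hmb : m < d := hm.2.trans (hS q hq).2.2
      refine hy a b c m d S hab hbc ham.le hmb.le hne (ih _ ?_ a b c m hab hbc ham.le ?_)
        (ih _ ?_ a b m d hab (by linarith) hmb.le ?_)
      · exact Finset.filter_ssubset.2 ⟨q, hq, not_lt.2 hm.2.le⟩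
      · intro r hr
        rw [Finset.mem_filter] at hr
        exact ⟨(hS r hr.1).1, ⟨(hS r hr.1).2.1, hr.2⟩⟩
      · exact Finset.filter_ssubset.2 ⟨p, hp, not_not.2 hm.1⟩
      · intro r hr
        rw [Finset.mem_filter] at hr
        exact ⟨(hS r hr.1).1, ⟨lt_of_le_of_ne (not_lt.1 hr.2) (hne r hr.1).symm, (hS r hr.1).2.2⟩⟩
    rcases lt_trichotomy q.1 p.1 with h | h | h
    · exact main1 q hq p hp h
    · rcases lt_trichotomy q.2 p.2 with h' | h' | h'
      · exact main2 q hq p hp h'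
      · exact absurd (Prod.ext h h') hqp
      · exact main2 p hp q hq h'
    · exact main1 p hp q hq h

lemma exists_small_square (hB : BoxNonneg B) {a b c d : ℝ} {p : ℝ × ℝ} (hbc : b < c)
    (h1 : p.1 ∈ Ioo a b) (h2 : p.2 ∈ Ioo c d) :
    ∃ ε > 0, a < p.1 - ε ∧ p.1 + ε < b ∧ c < p.2 - ε ∧ p.2 + ε < d ∧
      rect B (p.1 - ε) (p.1 + ε) (p.2 - ε) (p.2 + ε) = mass B p := by
  obtain ⟨ε₀, h3, -, h4⟩ := mass_spec hB (p := p) (by linarith [h1.2, h2.1])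
  obtain ⟨ε, h5, h6⟩ := exists_between (show 0 < min ε₀ (min (min (p.1 - a) (b - p.1))
    (min (p.2 - c) (d - p.2))) by
      simp only [lt_min_iff, sub_pos]
      exact ⟨h3, ⟨h1.1, h1.2⟩, h2.1, h2.2⟩)
  simp only [lt_min_iff] at h6
  exact ⟨ε, h5, by linarith [h6.2.1.1], by linarith [h6.2.1.2], by linarith [h6.2.2.1],
    by linarith [h6.2.2.2], h4 ε h5 h6.1.le⟩

lemma sum_mass_le_rect (hB : BoxNonneg B) (S : Finset (ℝ × ℝ)) {a b c d : ℝ} (hab : a ≤ b)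
    (hbc : b < c) (hcd : c ≤ d) (hS : ∀ p ∈ S, p.1 ∈ Ioo a b ∧ p.2 ∈ Ioo c d) :
    ((∑ p ∈ S, mass B p : ℕ) : ℤ) ≤ rect B a b c d := by
  refine box_induction (P := fun a b c d S => ((∑ p ∈ S, mass B p : ℕ) : ℤ) ≤ rect B a b c d)
    ?_ ?_ ?_ ?_ S a b c d hab hbc hcd hS
  · intro a b c d hab hbc hcd
    simpa using hB hab hbc hcd
  · intro a b c d p hbc h1 h2
    obtain ⟨ε, h3, h4, h5, h6, h7, h8⟩ := exists_small_square hB hbc h1 h2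
    simp only [Finset.sum_singleton]
    rw [← h8]
    exact rect_mono hB h4.le (by linarith) h5.le hbc h6.le (by linarith) h7.le
  · intro a m b c d S _ _ _ _ _ hl hr
    rw [← Finset.sum_filter_add_sum_filter_not S fun p => p.1 < m]
    have : rect B a b c d = rect B a m c d + rect B m b c d := by unfold rect; ring
    rw [this]; push_cast at *; linarith
  · intro a b c m d S _ _ _ _ _ hl hr
    rw [← Finset.sum_filter_add_sum_filter_not S fun p => p.2 < m]
    have : rect B a b c d = rect B a b c m + rect B a b m d := by unfold rect; ring
    rw [this]; push_cast at *; linarith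

/-- If the points of positive mass in the closure of a box lie in a finite subset of its interior,
the mass of the box is the sum of the masses of the points. -/
lemma rect_eq_sum_mass (hB : BoxNonneg B) (S : Finset (ℝ × ℝ)) {a b c d : ℝ} (hab : a ≤ b)
    (hbc : b < c) (hcd : c ≤ d) (hS : ∀ p ∈ S, p.1 ∈ Ioo a b ∧ p.2 ∈ Ioo c d)
    (hsupp : ∀ p : ℝ × ℝ, p.1 ∈ Icc a b → p.2 ∈ Icc c d → 0 < mass B p → p ∈ S) :
    rect B a b c d = ((∑ p ∈ S, mass B p : ℕ) : ℤ) := by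
  refine box_induction (P := fun a b c d S =>
    (∀ p : ℝ × ℝ, p.1 ∈ Icc a b → p.2 ∈ Icc c d → 0 < mass B p → p ∈ S) →
      rect B a b c d = ((∑ p ∈ S, mass B p : ℕ) : ℤ))
    ?_ ?_ ?_ ?_ S a b c d hab hbc hcd hS hsupp
  · intro a b c d hab hbc hcd h
    simpa using rect_eq_zero hB hab hbc hcd fun p h1 h2 => by simpa using h p h1 h2
  · intro a b c d p hbc h1 h2 h
    obtain ⟨ε, h3, h4, h5, h6, h7, h8⟩ := exists_small_square hB hbc h1 h2
    -- The four boxes that surround a small square at `p` carry no mass.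
    have hz : ∀ a' b' c' d', a ≤ a' → a' ≤ b' → b' ≤ b → c ≤ c' → c' ≤ d' → d' ≤ d →
        (p.1 ∉ Icc a' b' ∨ p.2 ∉ Icc c' d') → rect B a' b' c' d' = 0 := by
      intro a' b' c' d' k1 k2 k3 k4 k5 k6 k7
      refine rect_eq_zero hB k2 (by linarith) k5 fun q hq1 hq2 => ?_
      by_contra hne
      have hqp := h q ⟨k1.trans hq1.1, hq1.2.trans k3⟩ ⟨k4.trans hq2.1, hq2.2.trans k6⟩
        (Nat.pos_of_ne_zero hne)
      rw [Finset.mem_singleton] at hqp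
      subst hqp
      exact k7.elim (fun k => k hq1) fun k => k hq2
    have e1 := hz a (p.1 - ε) c d le_rfl h4.le (by linarith) le_rfl (by linarith) le_rfl
      (Or.inl fun k => by linarith [k.2])
    have e2 := hz (p.1 + ε) b c d (by linarith) h5.le le_rfl le_rfl (by linarith) le_rfl
      (Or.inl fun k => by linarith [k.1])
    have e3 := hz (p.1 - ε) (p.1 + ε) c (p.2 - ε) h4.le (by linarith) h5.le le_rfl h6.le
      (by linarith) (Or.inr fun k => by linarith [k.2])
    have e4 := hz (p.1 - ε) (p.1 + ε) (p.2 + ε) d h4.le (by linarith) h5.le (by linarith) h7.le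
      le_rfl (Or.inr fun k => by linarith [k.1])
    simp only [Finset.sum_singleton]
    rw [← h8]
    unfold rect at *
    linarith
  · intro a m b c d S _ _ _ _ hne hl hr h
    rw [← Finset.sum_filter_add_sum_filter_not S fun p => p.1 < m]
    have : rect B a b c d = rect B a m c d + rect B m b c d := by unfold rect; ring
    rw [this, hl ?_, hr ?_]; · push_cast; rfl
    · intro p h1 h2 h3
      have := h p ⟨by linarith [h1.1], h1.2⟩ h2 h3
      exact Finset.mem_filter.2 ⟨this, not_lt.2 h1.1⟩
    · intro p h1 h2 h3
      have := h p ⟨h1.1, by linarith [h1.2]⟩ h2 h3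
      exact Finset.mem_filter.2 ⟨this, lt_of_le_of_ne h1.2 (hne p this)⟩
  · intro a b c m d S _ _ _ _ hne hl hr h
    rw [← Finset.sum_filter_add_sum_filter_not S fun p => p.2 < m]
    have : rect B a b c d = rect B a b c m + rect B a b m d := by unfold rect; ring
    rw [this, hl ?_, hr ?_]; · push_cast; rfl
    · intro p h1 h2 h3
      have := h p h1 ⟨by linarith [h2.1], h2.2⟩ h3
      exact Finset.mem_filter.2 ⟨this, not_lt.2 h2.1⟩
    · intro p h1 h2 h3
      have := h p h1 ⟨h2.1, by linarith [h2.2]⟩ h3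
      exact Finset.mem_filter.2 ⟨this, lt_of_le_of_ne h2.2 (hne p this)⟩

lemma mem_closedBall_iff_abs {p q : ℝ × ℝ} {r : ℝ} :
    q ∈ Metric.closedBall p r ↔ |q.1 - p.1| ≤ r ∧ |q.2 - p.2| ≤ r := by
  rw [Metric.mem_closedBall, Prod.dist_eq, max_le_iff, Real.dist_eq, Real.dist_eq]

/-- Only finitely many points of positive mass lie in a ball away from the diagonal. -/
lemma finite_mass_pos (hB : BoxNonneg B) {p : ℝ × ℝ} {r : ℝ} (hr : 2 * r < p.2 - p.1) :
    {q | q ∈ Metric.closedBall p r ∧ 0 < mass B q}.Finite := by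
  rcases lt_or_ge r 0 with h | h
  · simp [Metric.closedBall_eq_empty.2 h]
  obtain ⟨s, hs1, hs2⟩ := exists_between (show r < (p.2 - p.1) / 2 by linarith)
  -- More points than the mass of a larger box would contradict `sum_mass_le_rect`.
  by_contra hinf
  obtain ⟨T, hT1, hT2⟩ := Set.Infinite.exists_subset_card_eq hinf
    ((rect B (p.1 - s) (p.1 + s) (p.2 - s) (p.2 + s)).toNat + 1)
  have hle := sum_mass_le_rect hB T (a := p.1 - s) (b := p.1 + s) (c := p.2 - s) (d := p.2 + s)
    (by linarith) (by linarith) (by linarith) (by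
      intro q hq
      have := mem_closedBall_iff_abs.1 (hT1 hq).1
      rw [abs_le, abs_le] at this
      exact ⟨⟨by linarith [this.1.1], by linarith [this.1.2]⟩,
        by linarith [this.2.1], by linarith [this.2.2]⟩)
  have hcard : T.card ≤ ∑ q ∈ T, mass B q := by
    rw [Finset.card_eq_sum_ones]
    exact Finset.sum_le_sum fun q hq => (hT1 hq).2
  omega

/-- The mass of a closed ball away from the diagonal is that of all slightly larger boxes. -/
lemma eventually_rect_eq_finsum (hB : BoxNonneg B) {p : ℝ × ℝ} {r : ℝ} (h0 : 0 ≤ r)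
    (hr : 2 * r < p.2 - p.1) :
    ∀ᶠ η in 𝓝[>] (0 : ℝ),
      rect B (p.1 - (r + η)) (p.1 + (r + η)) (p.2 - (r + η)) (p.2 + (r + η))
        = ((∑ᶠ q ∈ Metric.closedBall p r, mass B q : ℕ) : ℤ) := by
  obtain ⟨s, hs1, hs2⟩ := exists_between (show r < (p.2 - p.1) / 2 by linarith)
  have hfin := finite_mass_pos hB (p := p) (r := s) (by linarith)
  have hfinr := finite_mass_pos hB (p := p) (r := r) hr
  -- The finitely many points of positive mass outside the ball stay outside a larger ball.
  have hev : ∀ᶠ η in 𝓝[>] (0 : ℝ), ∀ q ∈ {q | q ∈ Metric.closedBall p s ∧ 0 < mass B q},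
      dist q p ≤ r + η → dist q p ≤ r := by
    rw [Filter.eventually_all_finite hfin]
    intro q _
    by_cases hq : dist q p ≤ r
    · exact Filter.Eventually.of_forall fun _ _ => hq
    · filter_upwards [Ioo_mem_nhdsGT (show 0 < dist q p - r by linarith)] with η hη h
      linarith [hη.2]
  filter_upwards [hev, Ioo_mem_nhdsGT (show 0 < s - r by linarith)] with η hη1 hη2
  rw [finsum_mem_eq_sum_of_inter_support_eq (t := hfinr.toFinset) _ (by
    ext q
    simp only [mem_inter_iff, Function.mem_support, Finite.coe_toFinset, mem_ofPred_eq]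
    have := Nat.pos_iff_ne_zero (n := mass B q)
    tauto)]
  refine rect_eq_sum_mass hB _ (by linarith [hη2.1]) (by linarith [hη2.2]) (by linarith [hη2.1])
    ?_ ?_
  · intro q hq
    rw [Finite.mem_toFinset] at hq
    have := mem_closedBall_iff_abs.1 hq.1
    rw [abs_le, abs_le] at this
    have h3 := hη2.1
    exact ⟨⟨by linarith [this.1.1], by linarith [this.1.2]⟩,
        by linarith [this.2.1], by linarith [this.2.2]⟩
  · intro q hq1 hq2 hq3
    rw [Finite.mem_toFinset]
    have hball : q ∈ Metric.closedBall p (r + η) := by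
      rw [mem_closedBall_iff_abs, abs_le, abs_le]
      exact ⟨⟨by linarith [hq1.1], by linarith [hq1.2]⟩,
        by linarith [hq2.1], by linarith [hq2.2]⟩
    exact ⟨hη1 q ⟨Metric.closedBall_subset_closedBall (by linarith [hη2.2]) hball, hq3⟩ hball, hq3⟩

/-! ### Ranks of pairs of nested sets -/

section Rank

variable {X : Type*} [TopologicalSpace X]

/-- The number of components of `B` that meet `A`, or `0` if `B` is the whole space: a sublevel set
is the whole space exactly from the maximum on, where the last component dies. -/
def nestedRank (A B : Set X) : ℕ :=
  open Classical in if B = univ then 0 else (connectedComponentIn B '' A).ncard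

lemma sublevelRank_eq_nestedRank (g : X → ℝ) (s t : ℝ) :
    sublevelRank g s t = nestedRank {x | g x ≤ s} {x | g x ≤ t} := by
  unfold sublevelRank nestedRank
  have : (∃ x, t < g x) ↔ ¬ ({x | g x ≤ t} = univ) := by
    simp [eq_univ_iff_forall]
  by_cases h : {x | g x ≤ t} = univ
  · rw [if_neg (by tauto), if_pos h]
  · rw [if_pos (by tauto), if_neg h]

lemma connectedComponentIn_eq_of_subset {B C : Set X} (hBC : B ⊆ C) {x y : X} (hy : y ∈ B)
    (h : connectedComponentIn B x = connectedComponentIn B y) :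
    connectedComponentIn C x = connectedComponentIn C y := by
  refine connectedComponentIn_eq (connectedComponentIn_mono x hBC ?_)
  rw [h]
  exact mem_connectedComponentIn hy

/-- Enlarging a set induces a map on its components. -/
lemma exists_component_map {B C : Set X} (hBC : B ⊆ C) :
    ∃ φ : Set X → Set X, ∀ x ∈ B, φ (connectedComponentIn B x) = connectedComponentIn C x := by
  classical
  refine ⟨fun K => if h : K.Nonempty then connectedComponentIn C h.some else ∅, fun x hx => ?_⟩
  have hne : (connectedComponentIn B x).Nonempty := ⟨x, mem_connectedComponentIn hx⟩
  simp only [dif_pos hne]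
  have hmem := hne.some_mem
  exact connectedComponentIn_eq_of_subset hBC hx (connectedComponentIn_eq hmem).symm

lemma finite_components_mono {A A' B B' : Set X} (hA : A' ⊆ A) (hAB : A ⊆ B) (hB : B ⊆ B')
    (h : (connectedComponentIn B '' A).Finite) : (connectedComponentIn B' '' A').Finite := by
  obtain ⟨φ, hφ⟩ := exists_component_map hB
  refine ((h.image φ).subset ?_)
  rintro _ ⟨x, hx, rfl⟩
  exact ⟨_, ⟨x, hA hx, rfl⟩, hφ x (hAB (hA hx))⟩

/-- A component of `D` that meets `B` but not `A` contains a component of `C` that meets `B` but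
not `A`; hence the mass of a box is nonnegative. -/
lemma nestedRank_box_nonneg {A B C D : Set X} (hAB : A ⊆ B) (hBC : B ⊆ C) (hCD : C ⊆ D)
    (hfin : (connectedComponentIn C '' B).Finite) :
    (0 : ℤ) ≤ nestedRank B C - nestedRank A C - nestedRank B D + nestedRank A D := by
  have hsub : connectedComponentIn C '' A ⊆ connectedComponentIn C '' B := image_mono hAB
  unfold nestedRank
  by_cases hC : C = univ
  · have hD : D = univ := univ_subset_iff.1 (hC ▸ hCD)
    simp [hC, hD]
  by_cases hD : D = univ
  · have := ncard_le_ncard hsub hfin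
    simp only [hC, hD, if_true, if_false]
    omega
  simp only [hC, hD, if_false]
  obtain ⟨φ, hφ⟩ := exists_component_map hCD
  have himg : ∀ E ⊆ C, connectedComponentIn D '' E = φ '' (connectedComponentIn C '' E) := by
    intro E hE
    rw [image_image]
    exact image_congr fun x hx => (hφ x (hE hx)).symm
  rw [himg A (hAB.trans hBC), himg B hBC]
  set Q := connectedComponentIn C '' B
  set R := connectedComponentIn C '' A
  have h1 := ncard_sdiff_add_ncard_of_subset hsub hfin
  have h2 := ncard_sdiff_add_ncard_of_subset (image_mono (f := φ) hsub) (hfin.image φ)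
  have hdiff : φ '' Q \ φ '' R ⊆ φ '' (Q \ R) := by
    rintro _ ⟨⟨K, hK, rfl⟩, hnot⟩
    exact ⟨K, ⟨hK, fun hKR => hnot ⟨K, hKR, rfl⟩⟩, rfl⟩
  have h3 : (φ '' Q \ φ '' R).ncard ≤ (Q \ R).ncard :=
    (ncard_le_ncard hdiff ((hfin.subset sdiff_subset).image φ)).trans
      (ncard_image_le (hfin.subset sdiff_subset))
  omega

/-- The box lemma for a chain of eight sets: the box spanned by the inner sets has at most
the mass of the box spanned by the outer sets. -/
lemma nestedRank_box_mono {A₁ A₂ A₃ A₄ A₅ A₆ A₇ A₈ : Set X} (h₁ : A₁ ⊆ A₂) (h₂ : A₂ ⊆ A₃)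
    (h₃ : A₃ ⊆ A₄) (h₄ : A₄ ⊆ A₅) (h₅ : A₅ ⊆ A₆) (h₆ : A₆ ⊆ A₇) (h₇ : A₇ ⊆ A₈)
    (hfin : (connectedComponentIn A₅ '' A₄).Finite) :
    (nestedRank A₃ A₆ : ℤ) - nestedRank A₂ A₆ - nestedRank A₃ A₇ + nestedRank A₂ A₇ ≤
      nestedRank A₄ A₅ - nestedRank A₁ A₅ - nestedRank A₄ A₈ + nestedRank A₁ A₈ := by
  have h58 := h₅.trans (h₆.trans h₇)
  have e1 := nestedRank_box_nonneg h₁ (h₂.trans (h₃.trans h₄)) h58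
    (finite_components_mono (h₂.trans h₃) h₄ subset_rfl hfin)
  have e2 := nestedRank_box_nonneg h₃ h₄ h58 hfin
  have e3 := nestedRank_box_nonneg h₂ (h₃.trans h₄) h₅
    (finite_components_mono h₃ h₄ subset_rfl hfin)
  have e4 := nestedRank_box_nonneg h₂ (h₃.trans (h₄.trans (h₅.trans h₆))) h₇
    (finite_components_mono h₃ h₄ (h₅.trans h₆) hfin)
  linarith

/-- The components of the open set `{g < t}` are open, so finitely many of them cover the compact
set `{g ≤ s}`. -/
lemma finite_components_sublevel [CompactSpace X] [LocallyConnectedSpace X] {g : X → ℝ}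
    (hg : Continuous g) {s t : ℝ} (hst : s < t) :
    (connectedComponentIn {x | g x ≤ t} '' {x | g x ≤ s}).Finite := by
  have hU : IsOpen {x | g x < t} := isOpen_lt hg continuous_const
  have hK : IsCompact {x | g x ≤ s} := (isClosed_le hg continuous_const).isCompact
  have hsub : {x | g x < t} ⊆ {x | g x ≤ t} := fun x (hx : g x < t) => hx.le
  obtain ⟨T, hT, hcov⟩ := hK.elim_nhds_subcover (fun x => connectedComponentIn {x | g x < t} x)
    fun x hx => connectedComponentIn_mem_nhds (hU.mem_nhds (lt_of_le_of_lt hx hst))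
  refine (T.finite_toSet.image (connectedComponentIn {x | g x ≤ t})).subset ?_
  rintro _ ⟨y, hy, rfl⟩
  obtain ⟨x, hx, hyx⟩ := mem_iUnion₂.1 (hcov hy)
  exact ⟨x, hx, connectedComponentIn_eq (connectedComponentIn_mono x hsub hyx)⟩

/-! ### Stability of the diagram -/

/-- The rank function of `g` with values in `ℤ`. -/
def rankFn (g : X → ℝ) (s t : ℝ) : ℤ := sublevelRank g s t

lemma mass_rankFn (g : X → ℝ) (p : ℝ × ℝ) : mass (rankFn g) p = pointMultiplicity g p := rfl

lemma fst_lt_snd_of_mem_diagramSupport {g : X → ℝ} {p : ℝ × ℝ} (hp : p ∈ diagramSupport g) :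
    p.1 < p.2 :=
  fst_lt_snd_of_mass_pos (B := rankFn g) hp

lemma ballMultiplicity_zero (g : X → ℝ) (p : ℝ × ℝ) :
    ballMultiplicity g 0 p = pointMultiplicity g p := by
  unfold ballMultiplicity
  rw [Metric.closedBall_zero, finsum_mem_singleton]

lemma ballMultiplicity_eq_of_forall {g : X → ℝ} {p q : ℝ × ℝ} {r : ℝ}
    (hq : q ∈ Metric.closedBall p r)
    (h : ∀ q' ∈ diagramSupport g, q' ∈ Metric.closedBall p r → q' = q) :
    ballMultiplicity g r p = pointMultiplicity g q := by
  unfold ballMultiplicity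
  rw [← finsum_mem_singleton (f := pointMultiplicity g) (a := q)]
  refine finsum_mem_inter_support_eq' _ _ _ fun q' hq' => ⟨fun h' => ?_, fun h' => ?_⟩
  · exact h q' (Nat.pos_of_ne_zero hq') h'
  · rwa [mem_singleton_iff.1 h']

lemma exists_mem_diagramSupport_of_ballMultiplicity_pos {g : X → ℝ} {p : ℝ × ℝ} {r : ℝ}
    (h : 0 < ballMultiplicity g r p) : ∃ q ∈ diagramSupport g, q ∈ Metric.closedBall p r := by
  by_contra hne
  push Not at hne
  refine h.ne' (finsum_mem_eq_zero_of_forall_eq_zero fun q hq => ?_)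
  by_contra h0
  exact hne q (Nat.pos_of_ne_zero h0) hq

variable [CompactSpace X] [LocallyConnectedSpace X] {g h : X → ℝ}

lemma boxNonneg_rankFn (hg : Continuous g) : BoxNonneg (rankFn g) := by
  intro a b c d hab hbc hcd
  simp only [rect, rankFn, sublevelRank_eq_nestedRank]
  exact nestedRank_box_nonneg (fun x hx => le_trans hx hab) (fun x hx => le_trans hx hbc.le)
    (fun x hx => le_trans hx hcd) (finite_components_sublevel hg hbc)

/-- The box lemma: the sublevel sets of `g` and `h` interleave, so they form a chain of eight
sets. -/
lemma rect_rankFn_le (hh : Continuous h) {ε : ℝ} (hgh : ∀ x, |g x - h x| ≤ ε) {a b c d : ℝ}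
    (hab : a ≤ b) (hbc : b + ε < c - ε) (hcd : c ≤ d) :
    rect (rankFn g) a b c d ≤ rect (rankFn h) (a - ε) (b + ε) (c - ε) (d + ε) := by
  have h1 : ∀ x, g x ≤ h x + ε := fun x => by linarith [(abs_le.1 (hgh x)).2]
  have h2 : ∀ x, h x ≤ g x + ε := fun x => by linarith [(abs_le.1 (hgh x)).1]
  simp only [rect, rankFn, sublevelRank_eq_nestedRank]
  refine nestedRank_box_mono (fun x hx => ?_) (fun x hx => ?_) (fun x hx => ?_) (fun x hx => ?_)
    (fun x hx => ?_) (fun x hx => ?_) (fun x hx => ?_) (finite_components_sublevel hh hbc)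
  all_goals
    simp only [mem_ofPred_eq] at hx ⊢
    linarith [h1 x, h2 x]

/-- Stability: the ball multiplicities of `g` are bounded by those of `h` with the
radius enlarged by the uniform distance. -/
lemma ballMultiplicity_le (hg : Continuous g) (hh : Continuous h) {ε : ℝ} (hε : 0 ≤ ε)
    (hgh : ∀ x, |g x - h x| ≤ ε) {p : ℝ × ℝ} {r : ℝ} (hr : 0 ≤ r)
    (hp : 2 * (r + ε) < p.2 - p.1) : ballMultiplicity g r p ≤ ballMultiplicity h (r + ε) p := by
  have e1 := eventually_rect_eq_finsum (boxNonneg_rankFn hg) (p := p) hr (by linarith)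
  have e2 := eventually_rect_eq_finsum (boxNonneg_rankFn hh) (p := p) (r := r + ε) (by linarith) hp
  obtain ⟨η, ⟨h1, h2⟩, h3⟩ := ((e1.and e2).and (Ioo_mem_nhdsGT
    (show 0 < (p.2 - p.1) / 2 - (r + ε) by linarith))).exists
  have hle := rect_rankFn_le (g := g) hh hgh (a := p.1 - (r + η)) (b := p.1 + (r + η))
    (c := p.2 - (r + η)) (d := p.2 + (r + η)) (by linarith [h3.1]) (by linarith [h3.2])
    (by linarith [h3.1])
  rw [h1, show p.1 - (r + η) - ε = p.1 - (r + ε + η) by ring,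
    show p.1 + (r + η) + ε = p.1 + (r + ε + η) by ring,
    show p.2 - (r + η) - ε = p.2 - (r + ε + η) by ring,
    show p.2 + (r + η) + ε = p.2 + (r + ε + η) by ring, h2] at hle
  exact_mod_cast hle

lemma ballMultiplicity_mono (hg : Continuous g) {p q : ℝ × ℝ} {r s : ℝ}
    (hs : 2 * s < q.2 - q.1) (hsub : Metric.closedBall p r ⊆ Metric.closedBall q s) :
    ballMultiplicity g r p ≤ ballMultiplicity g s q := by
  classical
  have hfin := finite_mass_pos (boxNonneg_rankFn hg) (p := q) (r := s) hs
  have e1 : ballMultiplicity g s q = ∑ q ∈ hfin.toFinset, pointMultiplicity g q := by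
    refine finsum_mem_eq_sum_of_inter_support_eq _ ?_
    ext x
    simp only [mem_inter_iff, Function.mem_support, Finite.coe_toFinset, mem_ofPred_eq,
      mass_rankFn]
    have := Nat.pos_iff_ne_zero (n := pointMultiplicity g x)
    tauto
  have e2 : ballMultiplicity g r p
      = ∑ q ∈ hfin.toFinset.filter (· ∈ Metric.closedBall p r), pointMultiplicity g q := by
    refine finsum_mem_eq_sum_of_inter_support_eq _ ?_
    ext x
    simp only [mem_inter_iff, Function.mem_support, Finset.coe_filter, Finite.mem_toFinset,
      mem_ofPred_eq, mass_rankFn]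
    have := Nat.pos_iff_ne_zero (n := pointMultiplicity g x)
    have := @hsub x
    tauto
  rw [e1, e2]
  exact Finset.sum_le_sum_of_subset (Finset.filter_subset _ _)

end Rank

/-! ### The estimator -/

section Estimator

/-- If `1` is the only common divisor of `A`, every common divisor of `N * A` divides `N`. -/
lemma dvd_of_forall_dvd_mul {A : Set ℕ} (hA : ∀ k, (∀ a ∈ A, k ∣ a) → k = 1) {N k : ℕ}
    (hN : 0 < N) (hk : ∀ a ∈ A, k ∣ N * a) : k ∣ N := by
  have hpos : 0 < Nat.gcd k N := Nat.gcd_pos_of_pos_right _ hN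
  have h1 : k / Nat.gcd k N = 1 := by
    refine hA _ fun a ha => ?_
    refine (Nat.coprime_div_gcd_div_gcd hpos).dvd_of_dvd_mul_left ?_
    rw [Nat.div_mul_right_comm (Nat.gcd_dvd_right k N)]
    exact Nat.div_dvd_div (Nat.gcd_dvd_left k N) (hk a ha)
  have h2 : k = Nat.gcd k N := by
    have := Nat.div_mul_cancel (Nat.gcd_dvd_left k N)
    rw [h1, one_mul] at this
    exact this.symm
  rw [h2]
  exact Nat.gcd_dvd_right k N

/-- If the elements of `A` are coprime, the gcd of `N * A` is `N`. -/
lemma setGcd_image_mul {A : Set ℕ} (hne : A.Nonempty) (hpos : ∀ a ∈ A, 0 < a)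
    (hA : setGcd A = 1) {N : ℕ} (hN : 0 < N) : setGcd ((fun a => N * a) '' A) = N := by
  obtain ⟨a₀, ha₀⟩ := hne
  unfold setGcd at hA ⊢
  rw [if_neg (Set.nonempty_iff_ne_empty.1 ⟨a₀, ha₀⟩)] at hA
  rw [if_neg (Set.nonempty_iff_ne_empty.1 (Set.Nonempty.image _ ⟨a₀, ha₀⟩))]
  have hbdd : BddAbove {k : ℕ | ∀ a ∈ A, k ∣ a} :=
    ⟨a₀, fun k hk => Nat.le_of_dvd (hpos a₀ ha₀) (hk a₀ ha₀)⟩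
  have hone : ∀ k, (∀ a ∈ A, k ∣ a) → k = 1 := by
    intro k hk
    have h1 : k ≤ 1 := hA ▸ le_csSup hbdd hk
    have h0 : k ≠ 0 := fun h => (hpos a₀ ha₀).ne' (Nat.eq_zero_of_zero_dvd (h ▸ hk a₀ ha₀))
    omega
  refine IsGreatest.csSup_eq ⟨?_, fun k hk => ?_⟩
  · rintro _ ⟨a, -, rfl⟩
    exact dvd_mul_right N a
  · exact Nat.le_of_dvd hN (dvd_of_forall_dvd_mul hone hN fun a ha => hk _ ⟨a, ha, rfl⟩)

variable {X Y : Type*} [TopologicalSpace X] [TopologicalSpace Y]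

lemma bddBelow_separation (g : X → ℝ) :
    BddBelow ({r | ∃ p ∈ diagramSupport g, ∃ q ∈ diagramSupport g, p ≠ q ∧ r = dist p q} ∪
    {r | ∃ p ∈ diagramSupport g, r = Metric.infDist p diagonal}) := by
  refine ⟨0, ?_⟩
  rintro r (⟨p, -, q, -, -, rfl⟩ | ⟨p, -, rfl⟩)
  · exact dist_nonneg
  · exact Metric.infDist_nonneg

lemma separation_le_dist {g : X → ℝ} {p q : ℝ × ℝ} (hp : p ∈ diagramSupport g)
    (hq : q ∈ diagramSupport g) (hpq : p ≠ q) : separation g ≤ dist p q :=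
  csInf_le (bddBelow_separation g) (Or.inl ⟨p, hp, q, hq, hpq, rfl⟩)

lemma two_mul_separation_le {g : X → ℝ} {p : ℝ × ℝ} (hp : p ∈ diagramSupport g) :
    2 * separation g ≤ p.2 - p.1 := by
  have h1 : separation g ≤ Metric.infDist p diagonal :=
    csInf_le (bddBelow_separation g) (Or.inr ⟨p, hp, rfl⟩)
  have h2 : Metric.infDist p diagonal ≤ dist p ((p.1 + p.2) / 2, (p.1 + p.2) / 2) :=
    Metric.infDist_le_dist_of_mem rfl
  have h3 : dist p ((p.1 + p.2) / 2, (p.1 + p.2) / 2) = (p.2 - p.1) / 2 := by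
    have := fst_lt_snd_of_mem_diagramSupport hp
    rw [Prod.dist_eq, Real.dist_eq, Real.dist_eq, abs_of_nonpos, abs_of_nonneg]
    · simp only
      rw [max_eq_left] <;> linarith
    · simp only; linarith
    · simp only; linarith
  linarith

lemma diagramSupport_nonempty_of_separation_pos {g : X → ℝ} (h : 0 < separation g) :
    (diagramSupport g).Nonempty := by
  by_contra hne
  rw [Set.not_nonempty_iff_eq_empty] at hne
  simp [separation, hne] at h

/-- If `F` is uniformly `τ / 2`-close to a function whose diagram is `N` times that of `f`, then
the estimator recovers `N`. -/
lemma estimator_eq [CompactSpace X] [LocallyConnectedSpace X] {f : Y → ℝ} {F h : X → ℝ}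
    (hF : Continuous F) (hh : Continuous h) {N : ℕ} (hN : 0 < N)
    (hmul : ∀ p, pointMultiplicity h p = N * pointMultiplicity f p)
    (hf : multiplicityGcd f = 1) {τ : ℝ} (hτ : 0 < τ) (hτf : τ < separation f / 3)
    (hFh : ∀ x, |F x - h x| ≤ τ / 2) : estimator F τ = N := by
  have hhF : ∀ x, |h x - F x| ≤ τ / 2 := fun x => abs_sub_comm (F x) (h x) ▸ hFh x
  have hsupp : diagramSupport h = diagramSupport f := by
    ext p
    simp [diagramSupport, hmul, hN]
  have hpers : ∀ q ∈ diagramSupport h, 6 * τ < q.2 - q.1 := fun q hq => by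
    linarith [two_mul_separation_le (hsupp ▸ hq)]
  -- A point of the diagram of `F` close to `q` sees exactly the point `q` of the diagram of `h`.
  have hball : ∀ q ∈ diagramSupport h, ∀ p ∈ Metric.closedBall q (τ / 2),
      ballMultiplicity F τ p = pointMultiplicity h q := by
    intro q hq p hp
    have hqp := mem_closedBall_iff_abs.1 hp
    rw [abs_le, abs_le] at hqp
    have hq6 := hpers q hq
    have hdist : dist p q ≤ τ / 2 := hp
    apply le_antisymm
    · refine (ballMultiplicity_le hF hh (by linarith) hFh hτ.le
        (by linarith [hqp.1.2, hqp.2.1])).trans ?_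
      rw [ballMultiplicity_eq_of_forall (q := q)]
      · rw [Metric.mem_closedBall, dist_comm]; linarith
      · intro q' hq' hq'p
        by_contra hne
        have h1 := separation_le_dist (hsupp ▸ hq') (hsupp ▸ hq) hne
        have h2 := dist_triangle q' p q
        rw [Metric.mem_closedBall] at hq'p
        linarith
    · rw [← ballMultiplicity_zero]
      refine (ballMultiplicity_le hh hF (by linarith) hhF le_rfl (by linarith)).trans ?_
      refine ballMultiplicity_mono hF (by linarith [hqp.1.2, hqp.2.1]) ?_
      refine Metric.closedBall_subset_closedBall' ?_
      rw [dist_comm]; linarith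
  have hset : {n | ∃ p ∈ diagramSupport F, 2 * τ < p.2 - p.1 ∧ n = ballMultiplicity F τ p}
      = (fun a => N * a) '' {n | ∃ p ∈ diagramSupport f, n = pointMultiplicity f p} := by
    ext n
    constructor
    · rintro ⟨p, hp, hpτ, rfl⟩
      have h1 := ballMultiplicity_le hF hh (by linarith) hFh le_rfl (p := p) (by linarith)
      rw [ballMultiplicity_zero, zero_add] at h1
      obtain ⟨q, hq, hqp⟩ :=
        exists_mem_diagramSupport_of_ballMultiplicity_pos (lt_of_lt_of_le hp h1)
      exact ⟨_, ⟨q, hsupp ▸ hq, rfl⟩, by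
        rw [hball q hq p (Metric.mem_closedBall_comm.1 hqp), hmul]⟩
    · rintro ⟨_, ⟨q, hq, rfl⟩, rfl⟩
      rw [← hsupp] at hq
      have hq6 := hpers q hq
      have h1 := ballMultiplicity_le hh hF (by linarith) hhF le_rfl (p := q) (by linarith)
      rw [ballMultiplicity_zero, zero_add] at h1
      obtain ⟨p, hp, hpq⟩ :=
        exists_mem_diagramSupport_of_ballMultiplicity_pos (lt_of_lt_of_le hq h1)
      have hqp := mem_closedBall_iff_abs.1 hpq
      rw [abs_le, abs_le] at hqp
      exact ⟨p, hp, by linarith [hqp.1.2, hqp.2.1], by rw [hball q hq p hpq, hmul]⟩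
  unfold estimator
  rw [hset]
  refine setGcd_image_mul ?_ ?_ hf hN
  · obtain ⟨p, hp⟩ := diagramSupport_nonempty_of_separation_pos (g := f) (by linarith)
    exact ⟨_, p, hp, rfl⟩
  · rintro _ ⟨p, hp, rfl⟩
    exact hp

end Estimator

/-! ### Coverings of the circle -/

instance : LocallyConnectedSpace UnitAddCircle :=
  (QuotientAddGroup.isQuotientMap_mk
    (N := AddSubgroup.zmultiples (1 : ℝ))).isCoinducing.locallyConnectedSpace

/-- The number of classes that a map distinguishes depends only on its kernel. -/
lemma encard_image_congr {α β γ : Type*} {S : Set α} {u : α → β} {v : α → γ}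
    (h : ∀ x ∈ S, ∀ y ∈ S, u x = u y ↔ v x = v y) : (u '' S).encard = (v '' S).encard := by
  obtain ⟨T, hTS, hT⟩ := exists_subset_bijOn S u
  have hinj : InjOn v T := fun x hx y hy hxy => hT.injOn hx hy ((h x (hTS hx) y (hTS hy)).2 hxy)
  have himg : v '' T = v '' S := by
    refine (image_mono hTS).antisymm ?_
    rintro _ ⟨x, hx, rfl⟩
    obtain ⟨y, hy, hyx⟩ := hT.surjOn ⟨x, hx, rfl⟩
    exact ⟨y, hy, (h y (hTS hy) x hx).1 hyx⟩
  rw [← hT.image_eq, hT.injOn.encard_image, ← himg, hinj.encard_image]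

lemma ordConnectedComponent_eq_iff {A : Set ℝ} {x y : ℝ} (hy : y ∈ A) :
    ordConnectedComponent A x = ordConnectedComponent A y ↔ uIcc x y ⊆ A := by
  refine ⟨fun h => ?_, fun h => ordConnectedComponent_eq h⟩
  have : y ∈ ordConnectedComponent A x := h ▸ self_mem_ordConnectedComponent.2 hy
  exact this

lemma continuous_periodic_lift {H : ℝ → ℝ} (hper : Function.Periodic H 1) (hH : Continuous H) :
    Continuous (hper.lift : UnitAddCircle → ℝ) :=
  continuous_quot_lift _ hH

/-- In the circle cut open at a point of the superlevel set, components of the sublevel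
set are intervals. -/
lemma connectedComponentIn_circle_eq_iff {H : ℝ → ℝ} (hper : Function.Periodic H 1) {t x₀ x y : ℝ}
    (hx₀ : t < H x₀) (hx : x ∈ Ioo x₀ (x₀ + 1)) (hy : y ∈ Ioo x₀ (x₀ + 1))
    (hxt : H x ≤ t) (hyt : H y ≤ t) :
    connectedComponentIn {z : UnitAddCircle | hper.lift z ≤ t} x
      = connectedComponentIn {z : UnitAddCircle | hper.lift z ≤ t} y ↔
        uIcc x y ⊆ {x | H x ≤ t} := by
  have hxm : (x : UnitAddCircle) ∈ {z : UnitAddCircle | hper.lift z ≤ t} := hxt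
  have hym : (y : UnitAddCircle) ∈ {z : UnitAddCircle | hper.lift z ≤ t} := hyt
  constructor
  · intro h
    set C := connectedComponentIn {z : UnitAddCircle | hper.lift z ≤ t} x with hC
    have hCsub : C ⊆ {z : UnitAddCircle | hper.lift z ≤ t} := connectedComponentIn_subset _ _
    -- The lift to `[x₀, x₀ + 1)` is continuous on the component, which misses the point `x₀`.
    set e : UnitAddCircle → ℝ := fun z => (AddCircle.equivIco 1 x₀ z : ℝ) with he
    have hcont : ContinuousOn e C := by
      intro z hz
      have hne : z ≠ (x₀ : UnitAddCircle) := by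
        rintro rfl
        exact not_lt.2 (hCsub hz) hx₀
      exact (continuous_subtype_val.continuousAt.comp
        (AddCircle.continuousAt_equivIco 1 x₀ hne)).continuousWithinAt
    have hpre : IsPreconnected (e '' C) :=
      isPreconnected_connectedComponentIn.image e hcont
    have hex : x ∈ e '' C := ⟨x, mem_connectedComponentIn hxm, by
      simp only [he]; rw [AddCircle.equivIco_coe_eq (Ioo_subset_Ico_self hx)]⟩
    have hey : y ∈ e '' C := ⟨y, h ▸ mem_connectedComponentIn hym, by
      simp only [he]; rw [AddCircle.equivIco_coe_eq (Ioo_subset_Ico_self hy)]⟩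
    intro w hw
    obtain ⟨z, hz, rfl⟩ := hpre.ordConnected.uIcc_subset hex hey hw
    have hze : ((e z : ℝ) : UnitAddCircle) = z := AddCircle.coe_equivIco
    have : hper.lift ((e z : ℝ) : UnitAddCircle) ≤ t := by rw [hze]; exact hCsub hz
    exact this
  · intro h
    refine connectedComponentIn_eq ?_
    have hpre : IsPreconnected ((fun r : ℝ => (r : UnitAddCircle)) '' uIcc x y) :=
      isPreconnected_uIcc.image _ (AddCircle.continuous_mk' 1).continuousOn
    refine hpre.subset_connectedComponentIn ⟨x, left_mem_uIcc, rfl⟩ ?_ ⟨y, right_mem_uIcc, rfl⟩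
    rintro _ ⟨w, hw, rfl⟩
    exact h hw

/-- The rank of a function on the circle, counted on the line in a period cut at a point of
the superlevel set. -/
lemma sublevelRank_lift {H : ℝ → ℝ} (hper : Function.Periodic H 1) {s t x₀ : ℝ} (hst : s ≤ t)
    (hx₀ : t < H x₀) :
    sublevelRank (hper.lift : UnitAddCircle → ℝ) s t
      = (ordConnectedComponent {x | H x ≤ t} ''
        ({x | H x ≤ s} ∩ Ioo x₀ (x₀ + 1))).encard.toNat := by
  have hex : ∃ z : UnitAddCircle, t < hper.lift z := ⟨x₀, hx₀⟩
  unfold sublevelRank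
  rw [if_pos hex]
  have himg : {z : UnitAddCircle | hper.lift z ≤ s}
      = (fun r : ℝ => (r : UnitAddCircle)) '' ({x | H x ≤ s} ∩ Ioo x₀ (x₀ + 1)) := by
    ext z
    constructor
    · intro hz
      have hze : ((AddCircle.equivIco 1 x₀ z : ℝ) : UnitAddCircle) = z := AddCircle.coe_equivIco
      have hHz : H (AddCircle.equivIco 1 x₀ z : ℝ) ≤ s := by
        rw [← hze] at hz; exact hz
      have hmem := (AddCircle.equivIco 1 x₀ z).2
      refine ⟨_, ⟨hHz, lt_of_le_of_ne hmem.1 fun h => ?_, hmem.2⟩, hze⟩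
      rw [← h] at hHz
      linarith
    · rintro ⟨x, hx, rfl⟩
      exact hx.1
  rw [himg, image_image, Set.ncard]
  congr 1
  refine encard_image_congr fun x hx y hy => ?_
  have hxt : H x ≤ t := le_trans hx.1 hst
  have hyt : H y ≤ t := le_trans hy.1 hst
  rw [connectedComponentIn_circle_eq_iff hper hx₀ hx.2 hy.2 hxt hyt,
    ordConnectedComponent_eq_iff (A := {x | H x ≤ t}) hyt]

/-- All windows of one period between consecutive cuts contain the same number of intervals. -/
lemma encard_window_translate {f : ℝ → ℝ} (hper : Function.Periodic f 1) {s t : ℝ} (hst : s ≤ t)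
    (x₀ : ℝ) (n : ℕ) :
    (ordConnectedComponent {x | f x ≤ t} '' ({x | f x ≤ s} ∩ Ioo (x₀ + n) (x₀ + n + 1))).encard
      = (ordConnectedComponent {x | f x ≤ t} '' ({x | f x ≤ s} ∩ Ioo x₀ (x₀ + 1))).encard := by
  have hper' : ∀ x, f (x + n) = f x := fun x => by simpa using hper.nat_mul n x
  have himg : {x | f x ≤ s} ∩ Ioo (x₀ + n) (x₀ + n + 1)
      = (fun x => x + (n : ℝ)) '' ({x | f x ≤ s} ∩ Ioo x₀ (x₀ + 1)) := by
    ext x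
    constructor
    · rintro ⟨h1, h2, h3⟩
      refine ⟨x - n, ⟨?_, by linarith, by linarith⟩, by ring⟩
      have := hper' (x - n)
      rw [sub_add_cancel] at this
      exact le_of_eq_of_le this.symm h1
    · rintro ⟨y, ⟨h1, h2, h3⟩, rfl⟩
      refine ⟨?_, by linarith, by linarith⟩
      exact le_of_eq_of_le (hper' y) h1
  rw [himg, image_image]
  refine encard_image_congr fun x hx y hy => ?_
  have hyt : f y ≤ t := le_trans hy.1 hst
  rw [ordConnectedComponent_eq_iff (A := {x | f x ≤ t}) hyt,
    ordConnectedComponent_eq_iff (A := {x | f x ≤ t}) (show f (y + n) ≤ t by rwa [hper']),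
    ← Set.image_add_const_uIcc, image_subset_iff]
  have : (fun x => x + (n : ℝ)) ⁻¹' {x | f x ≤ t} = {x | f x ≤ t} := by
    ext x
    simp [hper']
  rw [this]

/-- A window of `n` periods, cut at a point of the superlevel set, has `n` times as many intervals
as one period. -/
lemma encard_window {f : ℝ → ℝ} (hper : Function.Periodic f 1) {s t x₀ : ℝ} (hst : s ≤ t)
    (hx₀ : t < f x₀) (n : ℕ) :
    (ordConnectedComponent {x | f x ≤ t} '' ({x | f x ≤ s} ∩ Ioo x₀ (x₀ + n))).encard
      = n * (ordConnectedComponent {x | f x ≤ t} ''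
        ({x | f x ≤ s} ∩ Ioo x₀ (x₀ + 1))).encard := by
  induction n with
  | zero => simp
  | succ n ih =>
    have hcut : t < f (x₀ + n) := by
      have := hper.nat_mul n x₀
      simp only [mul_one] at this
      rwa [this]
    have hunion : {x | f x ≤ s} ∩ Ioo x₀ (x₀ + (n + 1 : ℕ))
        = ({x | f x ≤ s} ∩ Ioo x₀ (x₀ + n)) ∪ ({x | f x ≤ s} ∩ Ioo (x₀ + n) (x₀ + n + 1)) := by
      have hn : (0 : ℝ) ≤ n := Nat.cast_nonneg n
      ext x
      simp only [mem_inter_iff, mem_ofPred_eq, mem_Ioo, mem_union, Nat.cast_add, Nat.cast_one]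
      constructor
      · rintro ⟨h1, h2, h3⟩
        rcases lt_trichotomy x (x₀ + n) with h | h | h
        · exact Or.inl ⟨h1, h2, h⟩
        · rw [h] at h1; linarith
        · exact Or.inr ⟨h1, h, by linarith⟩
      · rintro (⟨h1, h2, h3⟩ | ⟨h1, h2, h3⟩)
        · exact ⟨h1, h2, by linarith⟩
        · exact ⟨h1, by linarith, by linarith⟩
    have hdisj : Disjoint
        (ordConnectedComponent {x | f x ≤ t} '' ({x | f x ≤ s} ∩ Ioo x₀ (x₀ + n)))
        (ordConnectedComponent {x | f x ≤ t} ''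
          ({x | f x ≤ s} ∩ Ioo (x₀ + n) (x₀ + n + 1))) := by
      rw [Set.disjoint_left]
      rintro _ ⟨x, hx, rfl⟩ ⟨y, hy, hxy⟩
      have h1 := (ordConnectedComponent_eq_iff (A := {x | f x ≤ t})
        (show f y ≤ t from le_trans hy.1 hst)).1 hxy.symm
      have h2 : f (x₀ + n) ≤ t := h1 (Set.mem_uIcc.2 (Or.inl ⟨hx.2.2.le, hy.2.1.le⟩))
      linarith
    rw [hunion, image_union, encard_union_eq hdisj, ih, encard_window_translate hper hst]
    push_cast
    ring

/-- Composition with a homeomorphism `E` of the line with `E (x + 1) = E x + N` multiplies all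
ranks by `N`. At and above the maximum both sides vanish by the convention on the last death
value. -/
lemma sublevelRank_cover {f : ℝ → ℝ} (hper : Function.Periodic f 1) (E : ℝ ≃o ℝ) {N : ℕ}
    (hE : ∀ x, E (x + 1) = E x + N) (hperE : Function.Periodic (f ∘ E) 1)
    {s t : ℝ} (hst : s ≤ t) :
    sublevelRank (hperE.lift : UnitAddCircle → ℝ) s t
      = N * sublevelRank (hper.lift : UnitAddCircle → ℝ) s t := by
  by_cases hex : ∃ x₀, t < f x₀
  · obtain ⟨x₀, hx₀⟩ := hex
    have hx₁ : t < (f ∘ E) (E.symm x₀) := by simpa using hx₀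
    rw [sublevelRank_lift hper hst hx₀, sublevelRank_lift hperE hst hx₁]
    have key := encard_window hper hst hx₀ N
    have hS : {x | f x ≤ s} ∩ Ioo x₀ (x₀ + N)
        = E '' ({x | (f ∘ E) x ≤ s} ∩ Ioo (E.symm x₀) (E.symm x₀ + 1)) := by
      ext x
      constructor
      · rintro ⟨h1, h2, h3⟩
        refine ⟨E.symm x, ⟨by simpa using h1, E.symm.strictMono h2, ?_⟩, by simp⟩
        rw [← E.lt_iff_lt, hE]
        simpa using h3
      · rintro ⟨y, ⟨h1, h2, h3⟩, rfl⟩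
        refine ⟨h1, E.symm_apply_lt.1 h2, ?_⟩
        have := E.strictMono h3
        rwa [hE, E.apply_symm_apply] at this
    have hcongr : (ordConnectedComponent {x | (f ∘ E) x ≤ t} ''
          ({x | (f ∘ E) x ≤ s} ∩ Ioo (E.symm x₀) (E.symm x₀ + 1))).encard
        = (ordConnectedComponent {x | f x ≤ t} '' ({x | f x ≤ s} ∩ Ioo x₀ (x₀ + N))).encard := by
      rw [hS, image_image]
      refine encard_image_congr fun x hx y hy => ?_
      have hyt : f (E y) ≤ t := le_trans hy.1 hst
      rw [ordConnectedComponent_eq_iff (A := {x | f x ≤ t}) hyt,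
        ordConnectedComponent_eq_iff (A := {x | (f ∘ E) x ≤ t}) hyt]
      constructor
      · intro h z hz
        have hz' := E.symm.monotone.mapsTo_uIcc hz
        rw [E.symm_apply_apply, E.symm_apply_apply] at hz'
        have := h hz'
        rwa [mem_ofPred_eq, Function.comp_apply, E.apply_symm_apply] at this
      · intro h z hz
        exact h (E.monotone.mapsTo_uIcc hz)
    rw [hcongr, key]
    simp
  · have h1 : ¬ ∃ z : UnitAddCircle, t < hper.lift z := by
      rintro ⟨z, hz⟩
      induction z using QuotientAddGroup.induction_on with
      | H x => exact hex ⟨x, hz⟩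
    have h2 : ¬ ∃ z : UnitAddCircle, t < hperE.lift z := by
      rintro ⟨z, hz⟩
      induction z using QuotientAddGroup.induction_on with
      | H x => exact hex ⟨E x, hz⟩
    simp [sublevelRank, h1, h2]

lemma pointMultiplicity_cover {f : ℝ → ℝ} (hf : Continuous f) (hper : Function.Periodic f 1)
    (E : ℝ ≃o ℝ) {N : ℕ} (hE : ∀ x, E (x + 1) = E x + N)
    (hperE : Function.Periodic (f ∘ E) 1) (p : ℝ × ℝ) :
    pointMultiplicity (hperE.lift : UnitAddCircle → ℝ) p
      = N * pointMultiplicity (hper.lift : UnitAddCircle → ℝ) p := by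
  have hc1 := boxNonneg_rankFn (continuous_periodic_lift hper hf)
  have hc2 := boxNonneg_rankFn (continuous_periodic_lift hperE (hf.comp E.continuous))
  rw [← mass_rankFn, ← mass_rankFn]
  by_cases hp : p.1 < p.2
  · obtain ⟨ε₁, h1, h2, h3⟩ := mass_spec hc1 hp
    obtain ⟨ε₂, h4, h5, h6⟩ := mass_spec hc2 hp
    set ε := min ε₁ ε₂
    have hε : 0 < ε := lt_min h1 h4
    have hε1 : ε ≤ ε₁ := min_le_left _ _
    have e1 := h3 ε hε hε1
    have e2 := h6 ε hε (min_le_right _ _)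
    simp only [rect, rankFn] at e1 e2
    rw [sublevelRank_cover hper E hE hperE (by linarith),
      sublevelRank_cover hper E hE hperE (by linarith),
      sublevelRank_cover hper E hE hperE (by linarith),
      sublevelRank_cover hper E hE hperE (by linarith)] at e2
    have : ((mass (rankFn (hperE.lift : UnitAddCircle → ℝ)) p : ℕ) : ℤ)
        = N * (mass (rankFn (hper.lift : UnitAddCircle → ℝ)) p : ℕ) := by
      rw [← e1, ← e2]
      push_cast
      ring
    exact_mod_cast this
  · have h1 : mass (rankFn (hperE.lift : UnitAddCircle → ℝ)) p = 0 :=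
      Nat.eq_zero_of_not_pos fun h => hp (fst_lt_snd_of_mass_pos h)
    have h2 : mass (rankFn (hper.lift : UnitAddCircle → ℝ)) p = 0 :=
      Nat.eq_zero_of_not_pos fun h => hp (fst_lt_snd_of_mass_pos h)
    rw [h1, h2, mul_zero]

/-- An increasing bijection `[0, 1] → [0, N]` extends to an order isomorphism `E` of the line with
`E (x + 1) = E x + N`. -/
lemma exists_orderIso_extension {φ : ℝ → ℝ} {N : ℕ} (hN : 0 < N) (hmono : StrictMonoOn φ (Icc 0 1))
    (hcont : ContinuousOn φ (Icc 0 1)) (h0 : φ 0 = 0) (h1 : φ 1 = N) :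
    ∃ E : ℝ ≃o ℝ, (∀ x, E (x + 1) = E x + N) ∧ ∀ x ∈ Ico (0 : ℝ) 1, E x = φ x := by
  have hNpos : (0 : ℝ) < N := Nat.cast_pos.2 hN
  have hfr : ∀ x : ℝ, Int.fract x ∈ Icc (0 : ℝ) 1 := fun x =>
    ⟨Int.fract_nonneg x, (Int.fract_lt_one x).le⟩
  set e : ℝ → ℝ := fun x => φ (Int.fract x) + N * (⌊x⌋ : ℝ) with he
  have hmonoe : StrictMono e := by
    intro x y hxy
    simp only [he]
    rcases eq_or_lt_of_le (Int.floor_mono hxy.le) with h | h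
    · rw [h]
      have : Int.fract x < Int.fract y := by
        unfold Int.fract; rw [h]; linarith
      linarith [hmono (hfr x) (hfr y) this]
    · have h2 : φ (Int.fract x) < N := h1 ▸ hmono (hfr x) ⟨zero_le_one, le_rfl⟩ (Int.fract_lt_one x)
      have h3 : 0 ≤ φ (Int.fract y) :=
        h0 ▸ hmono.monotoneOn ⟨le_rfl, zero_le_one⟩ (hfr y) (Int.fract_nonneg y)
      have h4 : ((⌊x⌋ : ℝ) + 1) ≤ ⌊y⌋ := by exact_mod_cast h
      nlinarith
  have hsurj : Function.Surjective e := by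
    intro y
    set k := ⌊y / N⌋
    have hk1 : (k : ℝ) * N ≤ y := (le_div_iff₀ hNpos).1 (Int.floor_le _)
    have hk2 : y < (k + 1) * N := (div_lt_iff₀ hNpos).1 (Int.lt_floor_add_one _)
    obtain ⟨u, hu, huy⟩ := intermediate_value_Ico zero_le_one hcont
      (show y - k * N ∈ Ico (φ 0) (φ 1) by rw [h0, h1]; exact ⟨by linarith, by linarith⟩)
    refine ⟨k + u, ?_⟩
    simp only [he]
    have hfl : ⌊(k : ℝ) + u⌋ = k := by
      rw [Int.floor_eq_iff]; exact ⟨by linarith [hu.1], by linarith [hu.2]⟩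
    have hfr : Int.fract ((k : ℝ) + u) = u := by
      unfold Int.fract; rw [hfl]; ring
    rw [hfr, hfl, huy]; ring
  refine ⟨hmonoe.orderIsoOfSurjective e hsurj, fun x => ?_, fun x hx => ?_⟩
  · simp only [StrictMono.coe_orderIsoOfSurjective, he, Int.fract_add_one, Int.floor_add_one]
    push_cast; ring
  · simp only [StrictMono.coe_orderIsoOfSurjective, he]
    rw [Int.fract_eq_self.2 hx, Int.floor_eq_zero_iff.2 hx]
    simp

/-! ### Error of linear interpolation -/

/-- If the derivative of `h` is `K`-Lipschitz, the chord of `h` over `[a, b]` is within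
`K (b - a)² / 4` of `h`. -/
lemma abs_chord_sub_le {h h' : ℝ → ℝ} {a b K : ℝ} (hab : a < b) (hK : 0 ≤ K)
    (hcont : ContinuousOn h (Icc a b)) (hderiv : ∀ x ∈ Ioo a b, HasDerivAt h (h' x) x)
    (hlip : ∀ x ∈ Ioo a b, ∀ y ∈ Ioo a b, |h' x - h' y| ≤ K * |x - y|) {θ : ℝ}
    (hθ0 : 0 ≤ θ) (hθ1 : θ ≤ 1) :
    |(1 - θ) * h a + θ * h b - h ((1 - θ) * a + θ * b)| ≤ K * (b - a) ^ 2 / 4 := by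
  have hrhs : 0 ≤ K * (b - a) ^ 2 / 4 := by positivity
  rcases eq_or_lt_of_le hθ0 with rfl | hθ0
  · simpa using hrhs
  rcases eq_or_lt_of_le hθ1 with rfl | hθ1
  · simpa using hrhs
  set t := (1 - θ) * a + θ * b with ht
  have hta : t - a = θ * (b - a) := by rw [ht]; ring
  have hbt : b - t = (1 - θ) * (b - a) := by rw [ht]; ring
  have hba : 0 < b - a := sub_pos.2 hab
  have h1 : a < t := by
    have : 0 < θ * (b - a) := by positivity
    linarith
  have h2 : t < b := by
    have : 0 < (1 - θ) * (b - a) := mul_pos (by linarith) hba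
    linarith
  obtain ⟨ξ, hξ, hξs⟩ := exists_hasDerivAt_eq_slope h h' h1
    (hcont.mono (Icc_subset_Icc_right h2.le)) fun x hx => hderiv x ⟨hx.1, hx.2.trans h2⟩
  obtain ⟨ζ, hζ, hζs⟩ := exists_hasDerivAt_eq_slope h h' h2
    (hcont.mono (Icc_subset_Icc_left h1.le)) fun x hx => hderiv x ⟨h1.trans hx.1, hx.2⟩
  rw [eq_div_iff (by linarith), hta] at hξs
  rw [eq_div_iff (by linarith), hbt] at hζs
  -- The error is a multiple of the difference of the slopes of the chords over `[t, b]` and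
  -- `[a, t]`, and the mean value theorem makes these slopes values of `h'`.
  have hid : (1 - θ) * h a + θ * h b - h t = θ * (1 - θ) * (b - a) * (h' ζ - h' ξ) := by
    linear_combination (1 - θ) * hξs - θ * hζs
  have hL := hlip ζ ⟨h1.trans hζ.1, hζ.2⟩ ξ ⟨hξ.1, hξ.2.trans h2⟩
  have hd : |ζ - ξ| ≤ b - a := by
    rw [abs_le]; constructor <;> linarith [hξ.1, hξ.2, hζ.1, hζ.2]
  have hq : θ * (1 - θ) ≤ 1 / 4 := by nlinarith [sq_nonneg (θ - 1 / 2)]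
  have hq0 : 0 ≤ θ * (1 - θ) := mul_nonneg hθ0.le (by linarith)
  rw [hid, abs_mul, abs_of_nonneg (mul_nonneg hq0 hba.le)]
  calc θ * (1 - θ) * (b - a) * |h' ζ - h' ξ|
      ≤ 1 / 4 * (b - a) * (K * (b - a)) := by
        refine mul_le_mul (mul_le_mul_of_nonneg_right hq hba.le)
          (hL.trans (mul_le_mul_of_nonneg_left hd hK)) (abs_nonneg _) (by positivity)
    _ = K * (b - a) ^ 2 / 4 := by ring

/-! ### Derivative bounds -/

lemma supDeriv_nonneg (k : ℕ) (f : ℝ → ℝ) : 0 ≤ supDeriv k f :=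
  Real.iSup_nonneg fun _ => abs_nonneg _

lemma supDerivUnit_nonneg (k : ℕ) (γ : ℝ → ℝ) : 0 ≤ supDerivUnit k γ :=
  Real.iSup_nonneg fun _ => abs_nonneg _

section Bounds

variable {f γ : ℝ → ℝ} {n : WithTop ℕ∞}

lemma abs_iteratedDeriv_le (hper : Function.Periodic f 1) (hf : ContDiff ℝ n f) {k : ℕ}
    (hk : k ≤ n) (x : ℝ) : |iteratedDeriv k f x| ≤ supDeriv k f := by
  have hperk : Function.Periodic (iteratedDeriv k f) 1 := fun x => by
    have h := iteratedDeriv_comp_add_const k f 1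
    have h2 : (fun z => f (z + 1)) = f := funext hper
    rw [h2] at h
    exact (congrFun h x).symm
  have hcont : Continuous fun x => |iteratedDeriv k f x| :=
    (hf.continuous_iteratedDeriv k hk).abs
  have hb := (hperk.comp abs).isBounded_of_continuous one_ne_zero hcont
  exact le_ciSup hb.bddAbove x

lemma abs_iteratedDeriv_sub_le (hper : Function.Periodic f 1) (hf : ContDiff ℝ n f) {k : ℕ}
    (hk : (k + 1 : ℕ) ≤ n) (x y : ℝ) :
    |iteratedDeriv k f y - iteratedDeriv k f x| ≤ supDeriv (k + 1) f * |y - x| := by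
  refine convex_univ.norm_image_sub_le_of_norm_deriv_le (f := iteratedDeriv k f)
    (fun z _ => ?_) (fun z _ => ?_) (mem_univ x) (mem_univ y)
  · exact (hf.differentiable_iteratedDeriv k
      (lt_of_lt_of_le (by exact_mod_cast k.lt_succ_self) hk)) z
  · rw [← iteratedDeriv_succ]
    exact abs_iteratedDeriv_le hper hf hk z

lemma abs_iteratedDerivWithin_le (hγ : ContDiffOn ℝ n γ (Icc 0 1)) {k : ℕ} (hk : k ≤ n) {x : ℝ}
    (hx : x ∈ Icc (0 : ℝ) 1) : |iteratedDerivWithin k γ (Icc 0 1) x| ≤ supDerivUnit k γ := by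
  have hcont : ContinuousOn (fun x => |iteratedDerivWithin k γ (Icc 0 1) x|) (Icc 0 1) :=
    (hγ.continuousOn_iteratedDerivWithin hk (uniqueDiffOn_Icc zero_lt_one)).abs
  have hb := isCompact_Icc.bddAbove_image hcont
  rw [image_eq_range] at hb
  exact le_ciSup hb ⟨x, hx⟩

lemma abs_iteratedDerivWithin_sub_le (hγ : ContDiffOn ℝ n γ (Icc 0 1)) {k : ℕ}
    (hk : (k + 1 : ℕ) ≤ n) {x y : ℝ} (hx : x ∈ Icc (0 : ℝ) 1) (hy : y ∈ Icc (0 : ℝ) 1) :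
    |iteratedDerivWithin k γ (Icc 0 1) y - iteratedDerivWithin k γ (Icc 0 1) x|
      ≤ supDerivUnit (k + 1) γ * |y - x| := by
  refine (convex_Icc (0 : ℝ) 1).norm_image_sub_le_of_norm_derivWithin_le
    (f := iteratedDerivWithin k γ (Icc 0 1)) ?_ (fun z hz => ?_) hx hy
  · exact hγ.differentiableOn_iteratedDerivWithin
      (lt_of_lt_of_le (by exact_mod_cast k.lt_succ_self) hk) (uniqueDiffOn_Icc zero_lt_one)
  · rw [← iteratedDerivWithin_succ]
    exact abs_iteratedDerivWithin_le hγ hk hz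

/-- The Lipschitz constant of the derivative of `f ∘ γ` given by the chain rule. -/
def chainConst (f γ : ℝ → ℝ) : ℝ :=
  supDeriv 2 f * supDerivUnit 1 γ ^ 2 + supDeriv 1 f * supDerivUnit 2 γ

lemma chainConst_nonneg (f γ : ℝ → ℝ) : 0 ≤ chainConst f γ := by
  have := supDeriv_nonneg 2 f
  have := supDeriv_nonneg 1 f
  have := supDerivUnit_nonneg 2 γ
  unfold chainConst
  positivity

/-- The third-order terms of `approxConst` are nonnegative. -/
lemma chainConst_le_approxConst (f γ : ℝ → ℝ) : chainConst f γ ≤ approxConst f γ := by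
  have := supDeriv_nonneg 1 f
  have := supDeriv_nonneg 2 f
  have := supDeriv_nonneg 3 f
  have := supDerivUnit_nonneg 1 γ
  have := supDerivUnit_nonneg 2 γ
  have := supDerivUnit_nonneg 3 γ
  unfold chainConst approxConst
  refine le_add_of_nonneg_right ?_
  positivity

lemma abs_chord_comp_sub_le (hper : Function.Periodic f 1) (hf : ContDiff ℝ 3 f)
    (hγ : ContDiffOn ℝ 3 γ (Icc 0 1)) {a b : ℝ} (ha : 0 ≤ a) (hab : a < b) (hb : b ≤ 1) {θ : ℝ}
    (hθ0 : 0 ≤ θ) (hθ1 : θ ≤ 1) :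
    |(1 - θ) * f (γ a) + θ * f (γ b) - f (γ ((1 - θ) * a + θ * b))|
      ≤ chainConst f γ * (b - a) ^ 2 / 4 := by
  have hsub : Icc a b ⊆ Icc 0 1 := Icc_subset_Icc ha hb
  refine abs_chord_sub_le (h := fun x => f (γ x))
    (h' := fun x => iteratedDeriv 1 f (γ x) * iteratedDerivWithin 1 γ (Icc 0 1) x)
    hab (chainConst_nonneg f γ)
    (hf.continuous.comp_continuousOn (hγ.continuousOn.mono hsub)) ?_ ?_ hθ0 hθ1
  · intro x hx
    have hxI : Icc (0 : ℝ) 1 ∈ 𝓝 x := Icc_mem_nhds (by linarith [hx.1]) (by linarith [hx.2])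
    have h1 : HasDerivAt f (deriv f (γ x)) (γ x) :=
      (hf.differentiable (by norm_num) _).hasDerivAt
    have h2 : HasDerivAt γ (derivWithin γ (Icc 0 1) x) x :=
      ((hγ.differentiableOn (by norm_num) x (mem_of_mem_nhds hxI)).hasDerivWithinAt).hasDerivAt hxI
    rw [iteratedDeriv_one, iteratedDerivWithin_one]
    exact h1.comp x h2
  · intro x hx y hy
    have hxI : x ∈ Icc (0 : ℝ) 1 := hsub (Ioo_subset_Icc_self hx)
    have hyI : y ∈ Icc (0 : ℝ) 1 := hsub (Ioo_subset_Icc_self hy)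
    have b1 := abs_iteratedDeriv_le (k := 1) hper hf (by norm_num) (γ y)
    have b2 := abs_iteratedDeriv_sub_le (k := 1) hper hf (by norm_num) (γ y) (γ x)
    have b3 := abs_iteratedDerivWithin_le (k := 1) hγ (by norm_num) hxI
    have b4 := abs_iteratedDerivWithin_sub_le (k := 1) hγ (by norm_num) hyI hxI
    have b5 := abs_iteratedDerivWithin_sub_le (k := 0) hγ (by norm_num) hyI hxI
    simp only [iteratedDerivWithin_zero, zero_add, Nat.reduceAdd] at b2 b4 b5
    have n1 := supDeriv_nonneg 1 f
    have n2 := supDeriv_nonneg 2 f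
    have n3 := supDerivUnit_nonneg 1 γ
    set F := iteratedDeriv 1 f
    set G := iteratedDerivWithin 1 γ (Icc 0 1)
    calc |F (γ x) * G x - F (γ y) * G y|
        = |(F (γ x) - F (γ y)) * G x + F (γ y) * (G x - G y)| := by congr 1; ring
      _ ≤ |F (γ x) - F (γ y)| * |G x| + |F (γ y)| * |G x - G y| := by
          rw [← abs_mul, ← abs_mul]; exact abs_add_le _ _
      _ ≤ (supDeriv 2 f * (supDerivUnit 1 γ * |x - y|)) * supDerivUnit 1 γ
          + supDeriv 1 f * (supDerivUnit 2 γ * |x - y|) :=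
          add_le_add
            (mul_le_mul (b2.trans (mul_le_mul_of_nonneg_left b5 n2)) b3 (abs_nonneg _)
              (by positivity))
            (mul_le_mul b1 b4 (abs_nonneg _) n1)
      _ = chainConst f γ * |x - y| := by unfold chainConst; ring

end Bounds

/-! ### Piecewise linear interpolation -/

lemma continuousOn_interpolate_one (a : ℕ → ℝ) (n : ℕ) :
    ContinuousOn (interpolate 1 a) (Icc 0 n) := by
  induction n with
  | zero => simp
  | succ n ih =>
    have hn : (0 : ℝ) ≤ n := Nat.cast_nonneg n
    have haff : ContinuousOn (fun v : ℝ => a (n + 1) * (v - n) + a n * (n + 1 - v))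
        (Icc (n : ℝ) (n + 1)) := by fun_prop
    have hpiece : ContinuousOn (interpolate 1 a) (Icc (n : ℝ) (n + 1)) := by
      refine haff.congr fun v hv => ?_
      rcases eq_or_lt_of_le hv.2 with h | h
      · have hfl : ⌊(n : ℝ) + 1⌋₊ = n + 1 := by
          exact_mod_cast Nat.floor_natCast (n + 1)
        simp only [interpolate, one_mul, h, hfl]
        push_cast
        ring
      · have hfl : ⌊v⌋₊ = n := (Nat.floor_eq_iff (hn.trans hv.1)).2 ⟨hv.1, h⟩
        simp only [interpolate, one_mul, hfl]
    have := ih.union_of_isClosed hpiece isClosed_Icc isClosed_Icc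
    rw [Icc_union_Icc_eq_Icc hn (by linarith)] at this
    exact_mod_cast this

lemma interpolate_eq_interpolate_one (ω : ℝ) (a : ℕ → ℝ) (t : ℝ) :
    interpolate ω a t = interpolate 1 a (ω * t) := by
  simp [interpolate]

lemma interpolatedSignal_coe {ω : ℝ} (hω : 0 < ω) {M : ℕ} [NeZero M] (S : Fin M → ℝ) {u : ℝ}
    (hu : u ∈ Ico (0 : ℝ) 1) :
    interpolatedSignal ω S u = interpolate 1 (fun k => S (Fin.ofNat M k)) (M * u) := by
  unfold interpolatedSignal onCircle
  rw [AddCircle.liftIco_zero_coe_apply hu, interpolate_eq_interpolate_one]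
  congr 1
  field_simp

lemma continuous_interpolatedSignal {ω : ℝ} (hω : 0 < ω) {M : ℕ} [NeZero M] (S : Fin M → ℝ) :
    Continuous (interpolatedSignal ω S) := by
  unfold interpolatedSignal onCircle
  have hfun : (fun t => interpolate ω (fun k => S (Fin.ofNat M k)) (M / ω * t))
      = fun t => interpolate 1 (fun k => S (Fin.ofNat M k)) (M * t) := by
    ext t
    rw [interpolate_eq_interpolate_one]
    congr 1
    field_simp
  rw [hfun]
  refine AddCircle.liftIco_zero_continuous ?_ ?_
  · simp only [interpolate, mul_zero, mul_one, Nat.floor_zero, Nat.floor_natCast, one_mul]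
    simp
  · refine (continuousOn_interpolate_one _ M).comp (by fun_prop) fun t ht => ?_
    have : (0 : ℝ) ≤ M := Nat.cast_nonneg M
    exact ⟨mul_nonneg this ht.1, by nlinarith [ht.2]⟩

/-! ### The time change of the sampled signal -/

/-- The sampling times `0, 1/ω, …, (M-1)/ω`, followed by the end `1` of the observation. -/
def sampleTime (ω : ℝ) (M k : ℕ) : ℝ := if k < M then k / ω else 1

/-- The time change that sends `k / M` to the `k`-th sampling time and is affine in between. It is
the maximum of two affine functions, since the last gap is at least as long as the others. -/
def timeChange (ω : ℝ) (M : ℕ) (u : ℝ) : ℝ :=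
  max (M * u / ω) ((M - 1) / ω + (M * u - (M - 1)) * (1 - (M - 1) / ω))

section TimeChange

variable {ω : ℝ} {M : ℕ}

/-- The last gap is less than `2 / ω` since `ω < M + 1`. -/
lemma sampleTime_step (hM : 1 ≤ M) (hMω : M ≤ ω) (hωM : ω < M + 1) {k : ℕ} (hk : k < M) :
    0 ≤ sampleTime ω M k ∧ sampleTime ω M k < sampleTime ω M (k + 1) ∧
      sampleTime ω M (k + 1) ≤ 1 ∧ sampleTime ω M (k + 1) - sampleTime ω M k ≤ 2 / ω := by
  have hM1 : (1 : ℝ) ≤ M := by exact_mod_cast hM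
  have hω : 0 < ω := by linarith
  have hk1 : (k : ℝ) + 1 ≤ M := by exact_mod_cast hk
  have hk0 : (0 : ℝ) ≤ k := Nat.cast_nonneg k
  have h0 : sampleTime ω M k = k / ω := if_pos hk
  rw [h0]
  by_cases h : k + 1 < M
  · have h1 : sampleTime ω M (k + 1) = (k + 1) / ω := by
      rw [sampleTime, if_pos h]; push_cast; rfl
    rw [h1, ← sub_div, div_lt_div_iff_of_pos_right hω, div_le_one hω,
      div_le_div_iff_of_pos_right hω]
    exact ⟨by positivity, by linarith, by linarith, by linarith⟩
  · have h1 : sampleTime ω M (k + 1) = 1 := if_neg h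
    have hkM : (k : ℝ) + 1 = M := by
      have : k + 1 = M := by omega
      exact_mod_cast this
    have hlast : 1 ≤ (2 + k) / ω := by
      rw [le_div_iff₀ hω]; linarith
    rw [h1, div_lt_one hω, sub_le_iff_le_add, ← add_div]
    exact ⟨by positivity, by linarith, le_rfl, hlast⟩

lemma timeChange_eq (hM : 1 ≤ M) (hMω : M ≤ ω) {k : ℕ} (hk : k < M) {u θ : ℝ}
    (hθ0 : 0 ≤ θ) (hθ1 : θ ≤ 1) (hu : M * u = k + θ) :
    timeChange ω M u = (1 - θ) * sampleTime ω M k + θ * sampleTime ω M (k + 1) := by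
  have hM1 : (1 : ℝ) ≤ M := by exact_mod_cast hM
  have hω : 0 < ω := by linarith
  have h0 : sampleTime ω M k = k / ω := if_pos hk
  have hgap : 1 / ω ≤ 1 - (M - 1) / ω := by
    rw [le_sub_iff_add_le, ← add_div, div_le_one hω]; linarith
  have hcmp : M * u / ω - ((M - 1) / ω + (M * u - (M - 1)) * (1 - (M - 1) / ω))
      = (M * u - (M - 1)) * (1 / ω - (1 - (M - 1) / ω)) := by ring
  unfold timeChange
  by_cases h : k + 1 < M
  · have h1 : sampleTime ω M (k + 1) = (k + 1) / ω := by
      rw [sampleTime, if_pos h]; push_cast; rfl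
    have hk2 : (k : ℝ) + 1 + 1 ≤ M := by exact_mod_cast h
    have : 0 ≤ (M * u - (M - 1)) * (1 / ω - (1 - (M - 1) / ω)) :=
      mul_nonneg_of_nonpos_of_nonpos (by linarith) (by linarith)
    rw [max_eq_left (by linarith), h0, h1, hu]
    ring
  · have h1 : sampleTime ω M (k + 1) = 1 := if_neg h
    have hkM : (M : ℝ) = k + 1 := by
      have : M = k + 1 := by omega
      exact_mod_cast this
    have : (M * u - (M - 1)) * (1 / ω - (1 - (M - 1) / ω)) ≤ 0 :=
      mul_nonpos_of_nonneg_of_nonpos (by linarith) (by linarith)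
    rw [max_eq_right (by linarith), h0, h1, hu, hkM]
    ring

lemma continuous_timeChange (ω : ℝ) (M : ℕ) : Continuous (timeChange ω M) := by
  unfold timeChange
  fun_prop

lemma strictMono_timeChange (hM : 1 ≤ M) (hMω : M ≤ ω) : StrictMono (timeChange ω M) := by
  have hM1 : (1 : ℝ) ≤ M := by exact_mod_cast hM
  have hω : 0 < ω := by linarith
  have hgap : 0 < 1 - (M - 1) / ω := by
    rw [sub_pos, div_lt_one hω]; linarith
  intro u v huv
  have h : M * u < M * v := mul_lt_mul_of_pos_left huv (by linarith)
  refine max_lt_max ?_ ?_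
  · exact div_lt_div_of_pos_right h hω
  · have := mul_lt_mul_of_pos_right (sub_lt_sub_right h (M - 1 : ℝ)) hgap
    linarith

lemma timeChange_zero (hM : 1 ≤ M) (hMω : M ≤ ω) : timeChange ω M 0 = 0 := by
  rw [timeChange_eq hM hMω (k := 0) (by omega) le_rfl zero_le_one (by simp)]
  simp [sampleTime, Nat.pos_iff_ne_zero.1 hM]

lemma timeChange_one (hM : 1 ≤ M) (hMω : M ≤ ω) : timeChange ω M 1 = 1 := by
  obtain ⟨k, rfl⟩ : ∃ k, M = k + 1 := ⟨M - 1, by omega⟩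
  rw [timeChange_eq hM hMω (k := k) (by omega) zero_le_one le_rfl (by push_cast; ring)]
  simp [sampleTime]

end TimeChange

section Signal

variable {f γ : ℝ → ℝ} {ω : ℝ} {M N : ℕ} [NeZero M]

/-- Each interpolated value is the value of `f ∘ γ` at a sampling time, up to the noise. For the
closing value this holds because `γ` takes `[0, 1]` to whole periods of `f`. -/
lemma exists_noisySample_eq (hper : Function.Periodic f 1) (hγ0 : γ 0 = 0) (hγ1 : γ 1 = N)
    (w : Fin M → ℝ) {k : ℕ} (hk : k ≤ M) :
    ∃ m, noisySample f γ ω w (Fin.ofNat M k) = f (γ (sampleTime ω M k)) + w m := by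
  refine ⟨Fin.ofNat M k, ?_⟩
  unfold noisySample
  congr 1
  rcases eq_or_lt_of_le hk with rfl | h
  · have : f N = f 0 := by simpa using hper.nat_mul N 0
    simp [sampleTime, hγ0, hγ1, this]
  · simp [sampleTime, h, Nat.mod_eq_of_lt h]

/-- Noise of size `α` and a curvature term bound the distance of the signal from the reparametrized
`f ∘ γ`. -/
lemma abs_interpolatedSignal_sub_le (hper : Function.Periodic f 1) (hf : ContDiff ℝ 3 f)
    (hγ : ContDiffOn ℝ 3 γ (Icc 0 1)) (hγ0 : γ 0 = 0) (hγ1 : γ 1 = N)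
    (hM : M = ⌊ω⌋₊) (hω : 1 ≤ ω) {E : ℝ → ℝ}
    (hE : ∀ x ∈ Ico (0 : ℝ) 1, E x = γ (timeChange ω M x)) (hperE : Function.Periodic (f ∘ E) 1)
    {w : Fin M → ℝ} {α : ℝ} (hw : ∀ m, |w m| ≤ α) (z : UnitAddCircle) :
    |interpolatedSignal ω (noisySample f γ ω w) z - hperE.lift z|
      ≤ α + 1 / ω ^ 2 * approxConst f γ := by
  have hωpos : 0 < ω := by linarith
  have hM1 : 1 ≤ M := Nat.one_le_iff_ne_zero.2 (NeZero.ne M)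
  have hMω : (M : ℝ) ≤ ω := hM ▸ Nat.floor_le hωpos.le
  have hωM : ω < M + 1 := hM ▸ Nat.lt_floor_add_one ω
  have hMpos : (0 : ℝ) < M := by exact_mod_cast hM1
  obtain ⟨u, hu, rfl⟩ := AddCircle.eq_coe_Ico z
  have hv0 : 0 ≤ M * u := mul_nonneg hMpos.le hu.1
  set k := ⌊(M : ℝ) * u⌋₊ with hk
  set θ := M * u - k with hθ
  have hθ0 : 0 ≤ θ := sub_nonneg.2 (Nat.floor_le hv0)
  have hθ1 : θ ≤ 1 := by
    have := Nat.lt_floor_add_one ((M : ℝ) * u)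
    linarith
  have hkM : k < M := (Nat.floor_lt hv0).2 (by nlinarith [hu.2])
  obtain ⟨m₀, h0⟩ := exists_noisySample_eq (ω := ω) hper hγ0 hγ1 w hkM.le
  obtain ⟨m₁, h1⟩ := exists_noisySample_eq (ω := ω) hper hγ0 hγ1 w hkM
  obtain ⟨s1, s2, s3, s4⟩ := sampleTime_step hM1 hMω hωM hkM
  have hlift : hperE.lift (u : UnitAddCircle) = f (E u) := rfl
  rw [hlift, hE u hu, timeChange_eq hM1 hMω hkM hθ0 hθ1 (by rw [hθ]; ring),
    interpolatedSignal_coe hωpos _ hu]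
  have hint : interpolate 1 (fun k => noisySample f γ ω w (Fin.ofNat M k)) (M * u)
      = (1 - θ) * f (γ (sampleTime ω M k)) + θ * f (γ (sampleTime ω M (k + 1)))
        + ((1 - θ) * w m₀ + θ * w m₁) := by
    simp only [interpolate, one_mul, ← hk]
    rw [h0, h1, hθ]
    ring
  rw [hint]
  set t₀ := sampleTime ω M k
  set t₁ := sampleTime ω M (k + 1)
  have hchord := abs_chord_comp_sub_le hper hf hγ s1 s2 s3 hθ0 hθ1
  have hnoise : |(1 - θ) * w m₀ + θ * w m₁| ≤ α := by
    have a0 := abs_le.1 (hw m₀)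
    have a1 := abs_le.1 (hw m₁)
    rw [abs_le]
    constructor <;> nlinarith
  have hK := chainConst_nonneg f γ
  have hsq : (t₁ - t₀) ^ 2 ≤ (2 / ω) ^ 2 := pow_le_pow_left₀ (by linarith) s4 2
  have hcurv : chainConst f γ * (t₁ - t₀) ^ 2 / 4 ≤ 1 / ω ^ 2 * approxConst f γ :=
    calc chainConst f γ * (t₁ - t₀) ^ 2 / 4 ≤ chainConst f γ * (2 / ω) ^ 2 / 4 := by gcongr
      _ = 1 / ω ^ 2 * chainConst f γ := by ring
      _ ≤ 1 / ω ^ 2 * approxConst f γ := by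
        gcongr
        exact chainConst_le_approxConst f γ
  calc _ = |((1 - θ) * f (γ t₀) + θ * f (γ t₁) - f (γ ((1 - θ) * t₀ + θ * t₁)))
          + ((1 - θ) * w m₀ + θ * w m₁)| := by congr 1; ring
    _ ≤ _ := (abs_add_le _ _).trans (by linarith)

end Signal

lemma onCircle_one_eq_lift {f : ℝ → ℝ} (hper : Function.Periodic f 1) :
    onCircle 1 f = hper.lift := by
  ext z
  obtain ⟨u, hu, rfl⟩ := AddCircle.eq_coe_Ico z
  unfold onCircle
  rw [AddCircle.liftIco_zero_coe_apply hu, one_mul]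
  rfl

/-- The estimator is correct on the event that all noise terms are at most `α`. -/
lemma estimator_interpolatedSignal_eq {f γ : ℝ → ℝ} (hper : Function.Periodic f 1)
    (hf : ContDiff ℝ 3 f) (hf_nondeg : multiplicityGcd (onCircle 1 f) = 1) {N : ℕ} (hN : 1 ≤ N)
    (hγ : ContDiffOn ℝ 3 γ (Icc 0 1)) (hγ_mono : StrictMonoOn γ (Icc 0 1))
    (hγ0 : γ 0 = 0) (hγ1 : γ 1 = N) {ω : ℝ} {M : ℕ} [NeZero M] (hM : M = ⌊ω⌋₊) (hω : 1 ≤ ω)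
    {w : Fin M → ℝ} {τ : ℝ} (hτ : 0 < τ) (hτδ : τ < separation (onCircle 1 f) / 3) {α : ℝ}
    (hα : α = τ / 2 - 1 / ω ^ 2 * approxConst f γ) (hw : ∀ m, |w m| ≤ α) :
    estimator (interpolatedSignal ω (noisySample f γ ω w)) τ = N := by
  have hM1 : 1 ≤ M := Nat.one_le_iff_ne_zero.2 (NeZero.ne M)
  have hMω : (M : ℝ) ≤ ω := hM ▸ Nat.floor_le (by linarith)
  have hmono := strictMono_timeChange hM1 hMω
  have hmaps : MapsTo (timeChange ω M) (Icc 0 1) (Icc 0 1) := fun u hu =>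
    ⟨timeChange_zero hM1 hMω ▸ hmono.monotone hu.1, timeChange_one hM1 hMω ▸ hmono.monotone hu.2⟩
  obtain ⟨E, hE1, hE2⟩ := exists_orderIso_extension (φ := fun x => γ (timeChange ω M x)) hN
    (fun u hu v hv huv => hγ_mono (hmaps hu) (hmaps hv) (hmono huv))
    (hγ.continuousOn.comp (continuous_timeChange ω M).continuousOn hmaps)
    (by rw [timeChange_zero hM1 hMω, hγ0]) (by rw [timeChange_one hM1 hMω, hγ1])
  have hperE : Function.Periodic (f ∘ E) 1 := fun x => by
    have := hper.nat_mul N (E x)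
    rw [mul_one] at this
    simp only [Function.comp_apply, hE1, this]
  rw [onCircle_one_eq_lift hper] at hf_nondeg hτδ
  refine estimator_eq (continuous_interpolatedSignal (by linarith) _)
    (continuous_periodic_lift hperE (hf.continuous.comp E.continuous)) hN
    (pointMultiplicity_cover hf.continuous hper E hE1 hperE) hf_nondeg hτ hτδ fun z => ?_
  have := abs_interpolatedSignal_sub_le hper hf hγ hγ0 hγ1 hM hω hE2 hperE hw z
  linarith

/-! ### The probability of small noise -/

lemma gaussianReal_real_Icc {σ : ℝ} (hσ : 0 < σ) {α : ℝ} (hα : 0 < α) :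
    (gaussianReal 0 (Real.toNNReal (σ ^ 2))).real (Icc (-α) α)
      = 1 - 2 * cdf (gaussianReal 0 1) (-(α / σ)) := by
  set μ := gaussianReal 0 1 with hμ
  have hscale : gaussianReal 0 (Real.toNNReal (σ ^ 2)) = μ.map (σ * ·) := by
    rw [hμ, gaussianReal_map_const_mul]
    simp only [mul_zero, mul_one]
    congr 1
    ext
    rw [Real.coe_toNNReal _ (by positivity)]
    rfl
  have hneg : μ.map (fun x => -x) = μ := by
    rw [hμ, gaussianReal_map_neg, neg_zero]
  have hatom : NullSingletonClass μ := nullSingletonClass_gaussianReal one_ne_zero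
  set c := α / σ with hc
  have hc0 : 0 < c := div_pos hα hσ
  have hpre : (fun x => σ * x) ⁻¹' Icc (-α) α = Icc (-c) c := by
    ext x
    simp only [mem_preimage, mem_Icc, hc, ← neg_div, div_le_iff₀ hσ, le_div_iff₀ hσ, mul_comm x σ]
  have hcompl : (Icc (-c) c)ᶜ = Iio (-c) ∪ Ioi c := by
    ext x
    simp only [mem_compl_iff, mem_Icc, mem_union, mem_Iio, mem_Ioi, not_and_or, not_le]
  have hdisj : Disjoint (Iio (-c)) (Ioi c) := by
    rw [Set.disjoint_left]
    intro x hx hx'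
    have h1 : x < -c := hx
    have h2 : c < x := hx'
    linarith
  have hIio : μ.real (Iio (-c)) = cdf μ (-c) := by
    rw [cdf_eq_real]
    exact measureReal_congr Iio_ae_eq_Iic
  have hIoi : μ.real (Ioi c) = cdf μ (-c) := by
    rw [← hIio]
    conv_rhs => rw [← hneg]
    rw [map_measureReal_apply measurable_neg measurableSet_Iio]
    congr 1
    ext x
    simp
  rw [hscale, map_measureReal_apply (by fun_prop) measurableSet_Icc, hpre]
  have := probReal_add_probReal_compl (μ := μ) (s := Icc (-c) c) measurableSet_Icc
  rw [hcompl, measureReal_union hdisj measurableSet_Ioi, hIio, hIoi] at this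
  linarith

lemma measureReal_forall_abs_le {Ω : Type*} [MeasurableSpace Ω] {P : Measure Ω}
    [IsProbabilityMeasure P] {σ : ℝ} (hσ : 0 < σ) {M : ℕ} {W : Fin M → Ω → ℝ}
    (hW_law : ∀ m, HasLaw (W m) (gaussianReal 0 (Real.toNNReal (σ ^ 2))) P)
    (hW_indep : iIndepFun W P) {α : ℝ} (hα : 0 < α) :
    P.real {x | ∀ m, |W m x| ≤ α} = (1 - 2 * cdf (gaussianReal 0 1) (-(α / σ))) ^ M := by
  have hset : {x | ∀ m, |W m x| ≤ α}
      = ⋂ m ∈ (Finset.univ : Finset (Fin M)), W m ⁻¹' Icc (-α) α := by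
    ext x
    simp [abs_le]
  have hprod := hW_indep.measure_inter_preimage_eq_mul Finset.univ
    (sets := fun _ => Icc (-α) α) fun _ _ => measurableSet_Icc
  rw [hset, measureReal_def, hprod, ENNReal.toReal_prod]
  rw [Finset.prod_congr rfl (g := fun _ => 1 - 2 * cdf (gaussianReal 0 1) (-(α / σ)))]
  · simp
  · intro m _
    rw [← gaussianReal_real_Icc hσ hα, ← (hW_law m).map_eq, measureReal_def,
      Measure.map_apply_of_aemeasurable (hW_law m).aemeasurable measurableSet_Icc]

end PeriodInference
end

open PeriodInference
theorem proposition9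
    -- the periodic function, with finitely many local extrema per period, non-degenerate
    (f : ℝ → ℝ) (hf_per : Function.Periodic f 1) (hf : ContDiff ℝ 3 f)
    (hf_extr : {x ∈ Set.Ico (0 : ℝ) 1 | IsLocalExtr f x}.Finite)
    (hf_nondeg : multiplicityGcd (onCircle 1 f) = 1)
    -- the increasing bijection from `[0, 1]` to `[0, N]`
    (N : ℕ) (hN : 1 ≤ N) (γ : ℝ → ℝ) (hγ : ContDiffOn ℝ 3 γ (Set.Icc 0 1))
    (hγ_mono : StrictMonoOn γ (Set.Icc 0 1))
    (hγ_bij : Set.BijOn γ (Set.Icc 0 1) (Set.Icc 0 (N : ℝ)))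
    -- the sampling rate, the number of samples and the noise
    (ω : ℝ) (M : ℕ) [NeZero M] (hM : M = ⌊ω⌋₊)
    {Ω : Type*} [MeasurableSpace Ω] (P : Measure Ω) [IsProbabilityMeasure P]
    (σ : ℝ) (hσ : 0 < σ) (W : Fin M → Ω → ℝ)
    (hW_law : ∀ m, HasLaw (W m) (gaussianReal 0 (Real.toNNReal (σ ^ 2))) P)
    (hW_indep : iIndepFun W P)
    -- the parameters `τ` and `α`
    (τ : ℝ) (hτ : 0 < τ) (hτδ : τ < separation (onCircle 1 f) / 3)
    (α : ℝ) (hα_def : α = τ / 2 - 1 / ω ^ 2 * approxConst f γ) (hα : 0 < α) :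
    (1 - 2 * cdf (gaussianReal 0 1) (-(α / σ))) ^ ω ≤
      P.real {x | estimator (interpolatedSignal ω (noisySample f γ ω fun m => W m x)) τ = N} := by
  have hω : 1 ≤ ω := (Nat.floor_pos).1 (hM ▸ Nat.pos_of_ne_zero (NeZero.ne M))
  have hMω : (M : ℝ) ≤ ω := hM ▸ Nat.floor_le (by linarith)
  have hN0 : (0 : ℝ) ≤ N := Nat.cast_nonneg N
  have h0I : (0 : ℝ) ∈ Set.Icc (0 : ℝ) 1 := ⟨le_rfl, zero_le_one⟩
  have h1I : (1 : ℝ) ∈ Set.Icc (0 : ℝ) 1 := ⟨zero_le_one, le_rfl⟩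
  -- An increasing bijection preserves the endpoints.
  have hγ0 : γ 0 = 0 := by
    obtain ⟨x, hx, hx0⟩ := hγ_bij.surjOn (⟨le_rfl, hN0⟩ : (0 : ℝ) ∈ Set.Icc 0 (N : ℝ))
    exact le_antisymm (hx0 ▸ hγ_mono.monotoneOn h0I hx hx.1) (hγ_bij.mapsTo h0I).1
  have hγ1 : γ 1 = N := by
    obtain ⟨x, hx, hxN⟩ := hγ_bij.surjOn (⟨hN0, le_rfl⟩ : (N : ℝ) ∈ Set.Icc 0 (N : ℝ))
    exact le_antisymm (hγ_bij.mapsTo h1I).2 (hxN ▸ hγ_mono.monotoneOn hx h1I hx.2)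
  have hbase := gaussianReal_real_Icc hσ hα
  have hb0 : 0 ≤ 1 - 2 * cdf (gaussianReal 0 1) (-(α / σ)) := hbase ▸ measureReal_nonneg
  have hb1 : 1 - 2 * cdf (gaussianReal 0 1) (-(α / σ)) ≤ 1 := hbase ▸ measureReal_le_one
  calc (1 - 2 * cdf (gaussianReal 0 1) (-(α / σ))) ^ ω
      ≤ (1 - 2 * cdf (gaussianReal 0 1) (-(α / σ))) ^ (M : ℝ) :=
        Real.rpow_le_rpow_of_exponent_ge' hb0 hb1 (Nat.cast_nonneg M) hMω
    _ = P.real {x | ∀ m, |W m x| ≤ α} := by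
        rw [Real.rpow_natCast, measureReal_forall_abs_le hσ hW_law hW_indep hα]
    _ ≤ _ := measureReal_mono fun x hx =>
        estimator_interpolatedSignal_eq hf_per hf hf_nondeg hN hγ hγ_mono hγ0 hγ1 hM hω hτ hτδ
          hα_def hx
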